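/- Let $V$ be a vector space of finite dimension $n$ over a field of characteristic $\neq 2$, and let $\xi$ be a nondegenerate symplectic (alternating) bilinear form on $V$. Write $U\perp W$ if $\xi(u,w)=0$ for all $u\in U$, $w\in W$, and $\mathrm{Rad}(U)=U\cap U^\perp$. A subspace $U$ is regular if $\mathrm{Rad}(U)=0$ and tangential if $\dim \mathrm{Rad}(U)=1$. The projective symplectic geometry $(\mathfrak P,\perp)$ consists of the points (1-dimensional subspaces) and lines (2-dimensional subspaces) of $V$ with inclusion and with the relation $\perp$; its automorphisms are the collineations that preserve $\perp$ in both directions. Let $\mathbf T_k$ be the set of tangential $k$-dimensional subspaces. For $U,W\in\mathbf T_k$ write $U\sim_- W$ if $U\cap W$ is a regular subspace of dimension $k-1$, and $U\sim^+ W$ if $U\neq W$ and $U,W$ lie in a common regular subspace of dimension $k+1$. Let $k$ be odd with $1\le k\le n-1$. (1) If $k\neq 1$, then $(\mathfrak P,\perp)$ is definable in $\langle \mathbf T_k,\sim_-\rangle$. If $k\neq n-1$, then $(\mathfrak P,\perp)$ is definable in $\langle\mathbf T_k,\sim^+\rangle$. Here definable means first-order interpretable without parameters: the points and the lines of $\mathfrak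 P$ can be coded by the tuples, of some fixed lengths, in parameter-free first-order definable sets of tuples of elements of $\mathbf T_k$ (each point and each line having at least one code), in such a way that the equality of coded points, the equality of coded lines, the incidence of points with lines, the orthogonality $\perp$ of points and lines, and the relation "the coded point is contained in $U$" for $U\in\mathbf T_k$ are all first-order definable without parameters. (2) If $k\neq 1$, then every bijection $f$ of $\mathbf T_k$ with $f(U)\sim_- f(W)\iff U\sim_- W$ for all $U,W\in\mathbf T_k$ is induced by an automorphism of $(\mathfrak P,\perp)$. If $k\neq n-1$, then every bijection $f$ of $\mathbf T_k$ with $f(U)\sim^+ f(W)\iff U\sim^+ W$ for all $U,W\in\mathbf T_k$ is induced by an automorphism of $(\mathfrak P,\perp)$. (An automorphism $\varphi$ induces $f$ if the points of $f(U)$ are exactly the images under $\varphi$ of the points of $U$, for all $U\in\mathbf T_k$.) -/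

import Mathlib

open Module

namespace SympGeom

/-! ### First-order definability from one binary relation -/

section Definability

variable {M X Y : Type*}

/-- The first-order structure `⟨M, r⟩` with one binary relation. -/
@[reducible]
def relStructure (r : M → M → Prop) : FirstOrder.Language.graph.Structure M where
  RelMap | .adj => fun x => r (x 0) (x 1)

/-- `s ⊆ M ^ α` is first-order definable, without parameters, in the structure `⟨M, r⟩`. -/
def DefinableIn (r : M → M → Prop) {α : Type} (s : Set (α → M)) : Prop :=
  letI := relStructure r
  (∅ : Set M).Definable FirstOrder.Language.graph s

/-- A coding of the objects of `X` by tuples of elements of `M`: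
the tuples in `dom` are codes, each code names one object, and each object is named. -/
structure Coding (M X : Type*) where
  /-- the length of the codes -/
  arity : ℕ
  /-- the set of codes -/
  dom : Set (Fin arity → M)
  /-- the object with a given code -/
  decode : dom → X
  /-- every object has a code -/
  surj : Function.Surjective decode

/-- The trivial coding of the elements of `M` by themselves. -/
def Coding.self (M : Type*) : Coding M M where
  arity := 1
  dom := Set.univ
  decode x := x.1 0
  surj m := ⟨⟨fun _ => m, trivial⟩, rfl⟩

/-- The relation `R` between coded objects, read as a relation between their codes,
is first-order definable, without parameters, in `⟨M, r⟩`. -/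
def CodedDefinable (r : M → M → Prop) (c : Coding M X) (d : Coding M Y)
    (R : X → Y → Prop) : Prop :=
  DefinableIn r {z : Fin c.arity ⊕ Fin d.arity → M |
    ∃ (h : (fun i => z (Sum.inl i)) ∈ c.dom) (h' : (fun j => z (Sum.inr j)) ∈ d.dom),
      R (c.decode ⟨_, h⟩) (d.decode ⟨_, h'⟩)}

end Definability

/-! ### Symplectic projective geometry -/

variable {F V : Type*} [Field F] [AddCommGroup V] [Module F V]

/-- The radical `U ∩ U^⊥` of a subspace `U`. -/
def rad (ξ : LinearMap.BilinForm F V) (U : Submodule F V) : Submodule F V :=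
  U ⊓ ξ.orthogonal U

/-- `U` is regular: its radical is the zero subspace. -/
def IsRegular (ξ : LinearMap.BilinForm F V) (U : Submodule F V) : Prop :=
  rad ξ U = ⊥

/-- `U` is tangential: its radical is a projective point. -/
def IsTangential (ξ : LinearMap.BilinForm F V) (U : Submodule F V) : Prop :=
  finrank F (rad ξ U) = 1

/-- `U ⊥ W`. -/
def Perp (ξ : LinearMap.BilinForm F V) (U W : Submodule F V) : Prop :=
  ∀ u ∈ U, ∀ w ∈ W, ξ u w = 0

variable (F V) in
/-- The subspaces of (linear) dimension `j`. -/
abbrev Sub (j : ℕ) : Type _ := {U : Submodule F V // finrank F U = j}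

variable (F V) in
/-- The points of the projective space over `V`. -/
abbrev Point : Type _ := Sub F V 1

variable (F V) in
/-- The lines of the projective space over `V`. -/
abbrev Line : Type _ := Sub F V 2

/-- The tangential `k`-subspaces. -/
abbrev Tang (ξ : LinearMap.BilinForm F V) (k : ℕ) : Type _ :=
  {U : Submodule F V // finrank F U = k ∧ IsTangential ξ U}

/-- `U ∩ W` is a regular `(k - 1)`-subspace. -/
def BotAdj (ξ : LinearMap.BilinForm F V) (k : ℕ) (U W : Tang ξ k) : Prop :=
  finrank F (U.1 ⊓ W.1 : Submodule F V) + 1 = k ∧ IsRegular ξ (U.1 ⊓ W.1)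

/-- `U ≠ W`, and `U`, `W` lie in a common regular `(k + 1)`-subspace. -/
def TopAdj (ξ : LinearMap.BilinForm F V) (k : ℕ) (U W : Tang ξ k) : Prop :=
  U ≠ W ∧ ∃ B : Submodule F V, finrank F B = k + 1 ∧ IsRegular ξ B ∧ U.1 ≤ B ∧ W.1 ≤ B

/-- The symplectic projective geometry of `(V, ξ)` -- points, lines, incidence and
orthogonality -- is first-order definable, without parameters, in `⟨T_k, r⟩`: points and lines
are coded by tuples of tangential `k`-subspaces so that equality of the coded objects, the
incidence of points with lines and all orthogonalities are definable. The codes name the points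
of the *underlying* geometry: that a coded point lies in a given tangential `k`-subspace is
definable too. -/
def DefinesGeometry (ξ : LinearMap.BilinForm F V) (k : ℕ)
    (r : Tang ξ k → Tang ξ k → Prop) : Prop :=
  ∃ (P : Coding (Tang ξ k) (Point F V)) (L : Coding (Tang ξ k) (Line F V)),
    DefinableIn r P.dom ∧ DefinableIn r L.dom ∧
    CodedDefinable r P P (fun p q => p = q) ∧
    CodedDefinable r L L (fun l m => l = m) ∧
    CodedDefinable r P L (fun p l => p.1 ≤ l.1) ∧
    CodedDefinable r P P (fun p q => Perp ξ p.1 q.1) ∧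
    CodedDefinable r P L (fun p l => Perp ξ p.1 l.1) ∧
    CodedDefinable r L L (fun l m => Perp ξ l.1 m.1) ∧
    CodedDefinable r P (Coding.self (Tang ξ k)) (fun p U => p.1 ≤ U.1)

/-- An automorphism of the symplectic projective geometry: a collineation (a bijection of
the points with a bijection of the lines, preserving and reflecting incidence) which preserves
and reflects the orthogonality of points, of points and lines, and of lines. -/
structure GeomAut (ξ : LinearMap.BilinForm F V) where
  /-- the action on points -/
  onPoint : Point F V ≃ Point F V
  /-- the action on lines -/
  onLine : Line F V ≃ Line F V
  incid : ∀ p l, (onPoint p).1 ≤ (onLine l).1 ↔ p.1 ≤ l.1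
  perp_pp : ∀ p q, Perp ξ (onPoint p).1 (onPoint q).1 ↔ Perp ξ p.1 q.1
  perp_pl : ∀ p l, Perp ξ (onPoint p).1 (onLine l).1 ↔ Perp ξ p.1 l.1
  perp_ll : ∀ l m, Perp ξ (onLine l).1 (onLine m).1 ↔ Perp ξ l.1 m.1

/-- The map `f` on tangential `k`-subspaces is determined (induced) by the automorphism `φ`:
the points of `f U` are the images of the points of `U`. -/
def GeomAut.Induces {ξ : LinearMap.BilinForm F V} {k : ℕ} (φ : GeomAut ξ)
    (f : Tang ξ k → Tang ξ k) : Prop :=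
  ∀ (U : Tang ξ k) (p : Point F V), (φ.onPoint p).1 ≤ (f U).1 ↔ p.1 ≤ U.1

end SympGeom

/-! A point is coded by the tangential subspaces whose radical it is, and a line by two points on
it. By nondegeneracy, S ≤ T holds iff every point orthogonal to T is orthogonal to S
(`le_iff_perp`). So by `definesGeometry_of_foRel` only two relations have to be defined:
orthogonality of radicals, and "the radical of U lies in W".

For `BotAdj` with k ≥ 3, three pairwise adjacent subspaces either share the intersection H of two of
them, or the third lies in the sum of the other two. If Z is not in U + W, every common neighbour of
U, W, Z contains the regular H, so the common neighbours form a clique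
(`eq_or_botAdj_of_not_le_sup`). If Z lies in U + W, there are two distinct non-adjacent common
neighbours (`SumTriangle.exists_not_botAdj`); here characteristic ≠ 2 enters. Thus `SumTriangle` is
definable.

Let p, q span the radicals of adjacent U, W. If p ⊥ q, the third vertices in U + W have radicals on
the line pq, and non-adjacent ones have equal radicals. If not, the hyperplanes of
`BotAdj.exists_hyperplane` violate transitivity of non-adjacency. This defines `OrthAdj`, hence
`RadAdj` (same radical, intersection of codimension at most one), and then equality of radicals,
because 2k steps of `RadAdj` join any two subspaces with the same radical (`rad_eq_iff_stepRel`).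
Orthogonality of radicals, and of a radical to a subspace, follow by existential quantification.

For `TopAdj`, orthogonal complementation carries T_k to T_{n-k}, keeps radicals and turns top
adjacency into bottom adjacency. Finally, definable sets are invariant under automorphisms, so an
automorphism of the adjacency structure acts on codes and thereby on points and lines
(`DefinesGeometry.exists_induces`). -/

namespace SympGeom

/-! ### Closure properties of definable predicates -/

section Predicates

variable {M N : Type*} {r : M → M → Prop} {ι : Type}

/-- The predicate `P` on tuples is first-order definable in `⟨M, r⟩`. -/
def FOPred (r : M → M → Prop) (P : (ι → M) → Prop) : Prop :=
  DefinableIn r {v | P v}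

/-- The binary relation `R` is first-order definable in `⟨M, r⟩`. -/
def FORel (r R : M → M → Prop) : Prop :=
  FOPred r fun v : Fin 2 → M => R (v 0) (v 1)

theorem FOPred.congr {P Q : (ι → M) → Prop} (h : FOPred r P) (e : ∀ v, Q v ↔ P v) :
    FOPred r Q := by
  have : Q = P := funext fun v => propext (e v)
  exact this ▸ h

theorem FORel.intro {R : M → M → Prop} (h : FOPred r fun v : Fin 2 → M => R (v 0) (v 1)) :
    FORel r R := h

theorem FORel.congr {R S : M → M → Prop} (h : FORel r R) (e : ∀ a b, S a b ↔ R a b) :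
    FORel r S :=
  FOPred.congr h fun _ => e _ _

theorem FOPred.and {P Q : (ι → M) → Prop} (hP : FOPred r P) (hQ : FOPred r Q) :
    FOPred r fun v => P v ∧ Q v :=
  let := relStructure r
  Set.Definable.inter hP hQ

theorem FOPred.or {P Q : (ι → M) → Prop} (hP : FOPred r P) (hQ : FOPred r Q) :
    FOPred r fun v => P v ∨ Q v :=
  let := relStructure r
  Set.Definable.union hP hQ

theorem FOPred.not {P : (ι → M) → Prop} (hP : FOPred r P) : FOPred r fun v => ¬ P v :=
  let := relStructure r
  Set.Definable.compl hP

theorem FOPred.imp {P Q : (ι → M) → Prop} (hP : FOPred r P) (hQ : FOPred r Q) :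
    FOPred r fun v => P v → Q v :=
  (hP.not.or hQ).congr fun _ => imp_iff_not_or

/-- Each quantifier adjoins a `Fin 1` summand to the index type: the innermost bound variable is
`Sum.inr 0`, and every outer variable gains one `Sum.inl`. -/
theorem FOPred.ex {P : (ι → M) → M → Prop}
    (hP : FOPred r fun v : ι ⊕ Fin 1 → M => P (fun i => v (.inl i)) (v (.inr 0))) :
    FOPred r fun v => ∃ m, P v m := by
  let := relStructure r
  refine FOPred.congr (P := fun v => ∃ w : Fin 1 → M, P v (w 0))
    (Set.Definable.exists_of_finite (β := Fin 1) hP) fun v => ?_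
  exact ⟨fun ⟨m, h⟩ => ⟨fun _ => m, h⟩, fun ⟨w, h⟩ => ⟨_, h⟩⟩

theorem FOPred.all {P : (ι → M) → M → Prop}
    (hP : FOPred r fun v : ι ⊕ Fin 1 → M => P (fun i => v (.inl i)) (v (.inr 0))) :
    FOPred r fun v => ∀ m, P v m :=
  (FOPred.ex (P := fun v m => ¬ P v m) hP.not).not.congr fun _ => by simp

theorem FORel.app {R : M → M → Prop} (h : FORel r R) (i j : ι) :
    FOPred r fun v : ι → M => R (v i) (v j) :=
  let := relStructure r
  Set.Definable.preimage_comp (![i, j] : Fin 2 → ι) h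

theorem FORel.self : FORel r r := by
  let := relStructure r
  refine Set.empty_definable_iff.2
    ⟨FirstOrder.Language.adj.formula₂ (FirstOrder.Language.Term.var 0)
      (FirstOrder.Language.Term.var 1), ?_⟩
  ext v
  simp [FirstOrder.Language.Formula.realize_rel₂, FirstOrder.Language.Structure.RelMap]

theorem FORel.eq : FORel r (fun a b => a = b) := by
  let := relStructure r
  refine Set.empty_definable_iff.2
    ⟨FirstOrder.Language.Term.equal (FirstOrder.Language.Term.var 0)
      (FirstOrder.Language.Term.var 1), ?_⟩
  ext v
  simp

/-- Isomorphic structures define the same relations. -/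
theorem DefinableIn.map_iff {s : N → N → Prop} (e : M ≃ N)
    (he : ∀ a b, s (e a) (e b) ↔ r a b) {S : Set (ι → N)} (h : DefinableIn s S) :
    DefinableIn r {v | (fun i => e (v i)) ∈ S} := by
  let := relStructure r
  let := relStructure s
  obtain ⟨φ, rfl⟩ := Set.empty_definable_iff.1 h
  refine Set.empty_definable_iff.2 ⟨φ, ?_⟩
  let E : FirstOrder.Language.graph.Equiv M N :=
    { e with
      map_fun' := fun f => nomatch f
      map_rel' := by
        rintro _ ⟨⟩ x
        exact he (x 0) (x 1) }
  ext v
  exact FirstOrder.Language.StrongHomClass.realize_formula E φ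

theorem FORel.map {s : N → N → Prop} (e : M ≃ N)
    (he : ∀ a b, s (e a) (e b) ↔ r a b) {S : N → N → Prop} (h : FORel s S) :
    FORel r fun a b => S (e a) (e b) :=
  DefinableIn.map_iff e he h

theorem DefinableIn.mem_iff (e : M ≃ M) (he : ∀ a b, r (e a) (e b) ↔ r a b) {S : Set (ι → M)}
    (h : DefinableIn r S) (v : ι → M) : (fun i => e (v i)) ∈ S ↔ v ∈ S := by
  let := relStructure r
  obtain ⟨φ, rfl⟩ := Set.empty_definable_iff.1 h
  let E : FirstOrder.Language.graph.Equiv M M :=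
    { e with
      map_fun' := fun f => nomatch f
      map_rel' := by
        rintro _ ⟨⟩ x
        exact he (x 0) (x 1) }
  exact FirstOrder.Language.StrongHomClass.realize_formula E φ

end Predicates

/-! ### The action of an automorphism on coded objects -/

section Action

variable {M X Y : Type*} {r : M → M → Prop}

theorem CodedDefinable.map_iff {c : Coding M X} {d : Coding M Y} {R : X → Y → Prop}
    (h : CodedDefinable r c d R) (e : M ≃ M) (he : ∀ a b, r (e a) (e b) ↔ r a b)
    (x : c.dom) (y : d.dom) (hx : (fun i => e (x.1 i)) ∈ c.dom)
    (hy : (fun i => e (y.1 i)) ∈ d.dom) :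
    R (c.decode ⟨_, hx⟩) (d.decode ⟨_, hy⟩) ↔ R (c.decode x) (d.decode y) := by
  have := DefinableIn.mem_iff e he h (Sum.elim x.1 y.1)
  constructor
  · intro H
    obtain ⟨_, _, H'⟩ := this.1 ⟨hx, hy, H⟩
    exact H'
  · intro H
    obtain ⟨_, _, H'⟩ := this.2 ⟨x.2, y.2, H⟩
    exact H'

/-- An automorphism of `⟨M, r⟩` permutes the coded objects. -/
theorem Coding.exists_perm {c : Coding M X} (hd : DefinableIn r c.dom)
    (heq : CodedDefinable r c c fun x y => x = y) (e : M ≃ M)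
    (he : ∀ a b, r (e a) (e b) ↔ r a b) :
    ∃ σ : X ≃ X, ∀ x : c.dom, ∃ hx : (fun i => e (x.1 i)) ∈ c.dom,
      σ (c.decode x) = c.decode ⟨_, hx⟩ := by
  have he' : ∀ a b, r (e.symm a) (e.symm b) ↔ r a b := fun a b => by
    simpa using (he (e.symm a) (e.symm b)).symm
  have mem : ∀ x : c.dom, (fun i => e (x.1 i)) ∈ c.dom := fun x =>
    (DefinableIn.mem_iff e he hd x.1).2 x.2
  have mem' : ∀ x : c.dom, (fun i => e.symm (x.1 i)) ∈ c.dom := fun x =>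
    (DefinableIn.mem_iff e.symm he' hd x.1).2 x.2
  -- The image of an object does not depend on the chosen code, because equality of decoded objects
  -- is definable and so respected by `e`.
  have key : ∀ x : c.dom, c.decode ⟨_, mem (Function.surjInv c.surj (c.decode x))⟩ =
      c.decode ⟨_, mem x⟩ := fun x =>
    (heq.map_iff e he _ x (mem _) (mem x)).2 (Function.surjInv_eq c.surj _)
  have key' : ∀ x : c.dom, c.decode ⟨_, mem' (Function.surjInv c.surj (c.decode x))⟩ =
      c.decode ⟨_, mem' x⟩ := fun x =>
    (heq.map_iff e.symm he' _ x (mem' _) (mem' x)).2 (Function.surjInv_eq c.surj _)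
  refine ⟨⟨fun a => c.decode ⟨_, mem (Function.surjInv c.surj a)⟩,
    fun a => c.decode ⟨_, mem' (Function.surjInv c.surj a)⟩, fun a => ?_, fun a => ?_⟩,
    fun x => ⟨mem x, key x⟩⟩
  · dsimp only
    rw [key']
    simp [Function.surjInv_eq]
  · dsimp only
    rw [key]
    simp [Function.surjInv_eq]

end Action

variable {F V : Type*} [Field F] [AddCommGroup V] [Module F V]

/-- If the geometry is definable in `⟨T_k, r⟩`, then every automorphism of `⟨T_k, r⟩` is induced
by an automorphism of the geometry. -/
theorem DefinesGeometry.exists_induces {ξ : LinearMap.BilinForm F V} {k : ℕ}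
    {r : Tang ξ k → Tang ξ k → Prop} (h : DefinesGeometry ξ k r) (f : Tang ξ k ≃ Tang ξ k)
    (hf : ∀ U W, r (f U) (f W) ↔ r U W) : ∃ φ : GeomAut ξ, φ.Induces f := by
  obtain ⟨P, L, hP, hL, hPP, hLL, hI, opp, opl, oll, hC⟩ := h
  obtain ⟨σ, hσ⟩ := Coding.exists_perm hP hPP f hf
  obtain ⟨τ, hτ⟩ := Coding.exists_perm hL hLL f hf
  refine ⟨⟨σ, τ, ?_, ?_, ?_, ?_⟩, ?_⟩
  · intro p l
    obtain ⟨x, rfl⟩ := P.surj p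
    obtain ⟨y, rfl⟩ := L.surj l
    obtain ⟨hx, ex⟩ := hσ x
    obtain ⟨hy, ey⟩ := hτ y
    rw [ex, ey]
    exact hI.map_iff f hf x y hx hy
  · intro p l
    obtain ⟨x, rfl⟩ := P.surj p
    obtain ⟨y, rfl⟩ := P.surj l
    obtain ⟨hx, ex⟩ := hσ x
    obtain ⟨hy, ey⟩ := hσ y
    rw [ex, ey]
    exact opp.map_iff f hf x y hx hy
  · intro p l
    obtain ⟨x, rfl⟩ := P.surj p
    obtain ⟨y, rfl⟩ := L.surj l
    obtain ⟨hx, ex⟩ := hσ x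
    obtain ⟨hy, ey⟩ := hτ y
    rw [ex, ey]
    exact opl.map_iff f hf x y hx hy
  · intro p l
    obtain ⟨x, rfl⟩ := L.surj p
    obtain ⟨y, rfl⟩ := L.surj l
    obtain ⟨hx, ex⟩ := hτ x
    obtain ⟨hy, ey⟩ := hτ y
    rw [ex, ey]
    exact oll.map_iff f hf x y hx hy
  · intro U p
    obtain ⟨x, rfl⟩ := P.surj p
    obtain ⟨hx, ex⟩ := hσ x
    change (σ _).1 ≤ _ ↔ _
    rw [ex]
    exact hC.map_iff f hf x (⟨fun _ => U, trivial⟩ : (Coding.self (Tang ξ k)).dom) hx trivial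

/-! ### Radicals and regular subspaces -/

section Radicals

variable {F V : Type*} [Field F] [AddCommGroup V] [Module F V]
variable {ξ : LinearMap.BilinForm F V}

theorem mem_sup_span {K : Submodule F V} {w x : V} :
    x ∈ K ⊔ Submodule.span F {w} ↔ ∃ h ∈ K, ∃ t : F, h + t • w = x := by
  simp [Submodule.mem_sup, Submodule.mem_span_singleton]

theorem mem_rad {U : Submodule F V} {x : V} :
    x ∈ rad ξ U ↔ x ∈ U ∧ ∀ u ∈ U, ξ u x = 0 := Iff.rfl

theorem isRegular_iff {H : Submodule F V} :
    IsRegular ξ H ↔ ∀ x ∈ H, (∀ y ∈ H, ξ y x = 0) → x = 0 := by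
  rw [IsRegular, Submodule.eq_bot_iff]
  exact ⟨fun h x h1 h2 => h x ⟨h1, h2⟩, fun h x hx => h x hx.1 hx.2⟩

/-- The radical of `U` is the point spanned by `p`. -/
def HasRad (ξ : LinearMap.BilinForm F V) (U : Submodule F V) (p : V) : Prop :=
  p ≠ 0 ∧ rad ξ U = Submodule.span F {p}

namespace HasRad

variable {U : Submodule F V} {p : V}

theorem mem_rad (h : HasRad ξ U p) : p ∈ rad ξ U := h.2 ▸ Submodule.mem_span_singleton_self p

theorem mem (h : HasRad ξ U p) : p ∈ U := h.mem_rad.1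

theorem right (h : HasRad ξ U p) {u : V} (hu : u ∈ U) : ξ u p = 0 := h.mem_rad.2 u hu

theorem left (hξ : ξ.IsAlt) (h : HasRad ξ U p) {u : V} (hu : u ∈ U) : ξ p u = 0 :=
  hξ.isRefl _ _ (h.right hu)

theorem exists_smul (h : HasRad ξ U p) {x : V} (hx : x ∈ U) (hx' : ∀ u ∈ U, ξ u x = 0) :
    ∃ t : F, t • p = x := by
  have : x ∈ rad ξ U := ⟨hx, hx'⟩
  rwa [h.2, Submodule.mem_span_singleton] at this

theorem of_span_eq (h : HasRad ξ U p) {q : V}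
    (e : Submodule.span F {p} = Submodule.span F {q}) : HasRad ξ U q := by
  refine ⟨?_, h.2.trans e⟩
  rintro rfl
  simp [h.1] at e

theorem smul (h : HasRad ξ U p) {t : F} (ht : t ≠ 0) : HasRad ξ U (t • p) :=
  h.of_span_eq (Submodule.span_singleton_smul_eq (IsUnit.mk0 t ht) p).symm

theorem isTangential (h : HasRad ξ U p) : IsTangential ξ U := by
  rw [IsTangential, h.2, finrank_span_singleton h.1]

theorem of_mem (hU : IsTangential ξ U) (hp : p ≠ 0) (hpU : p ∈ U)
    (h : ∀ u ∈ U, ξ u p = 0) : HasRad ξ U p := by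
  refine ⟨hp, ?_⟩
  have h1 : p ∈ rad ξ U := ⟨hpU, h⟩
  have : FiniteDimensional F (rad ξ U) := FiniteDimensional.of_finrank_eq_succ hU
  refine (Submodule.eq_of_le_of_finrank_eq
    ((Submodule.span_singleton_le_iff_mem _ _).2 h1) ?_).symm
  rw [finrank_span_singleton hp]
  exact hU.symm

theorem of_iff {W : Submodule F V} (h : HasRad ξ U p) (e : rad ξ W = rad ξ U) :
    HasRad ξ W p := ⟨h.1, e.trans h.2⟩

end HasRad

theorem HasRad.perp_iff {U W : Submodule F V} {p q : V} (hp : HasRad ξ U p)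
    (hq : HasRad ξ W q) : Perp ξ (rad ξ U) (rad ξ W) ↔ ξ p q = 0 := by
  refine ⟨fun h => h p hp.mem_rad q hq.mem_rad, fun h u hu w hw => ?_⟩
  rw [hp.2, Submodule.mem_span_singleton] at hu
  rw [hq.2, Submodule.mem_span_singleton] at hw
  obtain ⟨a, rfl⟩ := hu
  obtain ⟨b, rfl⟩ := hw
  simp [h]

theorem perp_rad_iff {U : Submodule F V} {p : V} (hp : HasRad ξ U p) (W : Submodule F V) :
    Perp ξ (rad ξ U) W ↔ ∀ w ∈ W, ξ p w = 0 := by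
  refine ⟨fun h w hw => h p hp.mem_rad w hw, fun h u hu w hw => ?_⟩
  rw [hp.2, Submodule.mem_span_singleton] at hu
  obtain ⟨a, rfl⟩ := hu
  simp [h w hw]

theorem IsTangential.exists_hasRad {U : Submodule F V} (h : IsTangential ξ U) :
    ∃ p, HasRad ξ U p := by
  obtain ⟨⟨v, hv⟩, hv0, hspan⟩ := finrank_eq_one_iff'.1 h
  refine ⟨v, fun h0 => hv0 (by simpa using h0), le_antisymm (fun x hx => ?_)
    ((Submodule.span_singleton_le_iff_mem _ _).2 hv)⟩
  obtain ⟨c, hc⟩ := hspan ⟨x, hx⟩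
  exact Submodule.mem_span_singleton.2 ⟨c, by simpa using congrArg Subtype.val hc⟩

theorem IsRegular.notMem {H : Submodule F V} (h : IsRegular ξ H) {w : V}
    (hw0 : w ≠ 0) (hw : ∀ y ∈ H, ξ y w = 0) : w ∉ H :=
  fun hm => hw0 (isRegular_iff.1 h w hm hw)

theorem IsRegular.hasRad_sup (hξ : ξ.IsAlt) {H : Submodule F V} (h : IsRegular ξ H) {w : V}
    (hw0 : w ≠ 0) (hw : ∀ y ∈ H, ξ y w = 0) : HasRad ξ (H ⊔ Submodule.span F {w}) w := by
  refine ⟨hw0, le_antisymm (fun x hx => ?_)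
    ((Submodule.span_singleton_le_iff_mem _ _).2 ⟨mem_sup_span.2 ⟨0, H.zero_mem, 1, by simp⟩,
      fun u hu => ?_⟩)⟩
  · obtain ⟨y, hy, t, rfl⟩ := mem_sup_span.1 hx.1
    have : y = 0 := isRegular_iff.1 h y hy fun z hz => by
      have := hx.2 z (Submodule.mem_sup_left hz)
      simpa [hw z hz] using this
    subst this
    exact Submodule.mem_span_singleton.2 ⟨t, by simp⟩
  · obtain ⟨y, hy, t, rfl⟩ := mem_sup_span.1 hu
    simp [hw y hy, hξ.self_eq_zero]

variable [FiniteDimensional F V]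

theorem sup_span_eq_of_finrank {K U : Submodule F V} {p : V} (hKU : K ≤ U)
    (hp : p ∈ U) (hpK : p ∉ K) (hd : finrank F K + 1 = finrank F U) :
    K ⊔ Submodule.span F {p} = U := by
  refine Submodule.eq_of_le_of_finrank_eq
    (sup_le hKU ((Submodule.span_singleton_le_iff_mem _ _).2 hp)) ?_
  rw [Submodule.finrank_sup_span_singleton hpK, hd]

/-- A vector of Rad K is orthogonal to K and to p, hence to U = K + ⟨p⟩; it is then a multiple of p,
and p ∉ K makes it zero. -/
theorem HasRad.isRegular_of_notMem (hξ : ξ.IsAlt) {U K : Submodule F V} {p : V}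
    (h : HasRad ξ U p) (hKU : K ≤ U) (hpK : p ∉ K) (hd : finrank F K + 1 = finrank F U) :
    IsRegular ξ K := by
  rw [isRegular_iff]
  intro x hx hx'
  have e := sup_span_eq_of_finrank hKU h.mem hpK hd
  obtain ⟨t, rfl⟩ := h.exists_smul (hKU hx) (fun u hu => by
    rw [← e, mem_sup_span] at hu
    obtain ⟨y, hy, s, rfl⟩ := hu
    simp [hx' y hy, h.left hξ (hKU hx)])
  by_cases ht : t = 0
  · simp [ht]
  · exact absurd ((K.smul_mem_iff ht).1 hx) hpK

/-- Decomposition of a vector along a regular subspace. -/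
theorem IsRegular.exists_add (hξ : ξ.IsAlt) {H : Submodule F V} (h : IsRegular ξ H) (v : V) :
    ∃ x ∈ H, ∃ w, (∀ y ∈ H, ξ y w = 0) ∧ x + w = v := by
  have hc := (LinearMap.BilinForm.isCompl_orthogonal_iff_disjoint (W := H) hξ.isRefl).2
    (disjoint_iff.2 h)
  obtain ⟨x, hx, w, hw, e⟩ := Submodule.mem_sup.1
    (hc.sup_eq_top ▸ Submodule.mem_top : v ∈ H ⊔ ξ.orthogonal H)
  exact ⟨x, hx, w, hw, e⟩

theorem IsRegular.finrank_sup {H : Submodule F V} (h : IsRegular ξ H) {w : V}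
    (hw0 : w ≠ 0) (hw : ∀ y ∈ H, ξ y w = 0) :
    finrank F (H ⊔ Submodule.span F {w} : Submodule F V) = finrank F H + 1 :=
  Submodule.finrank_sup_span_singleton (h.notMem hw0 hw)

/-- A subspace with a regular hyperplane is tangential. -/
theorem IsRegular.isTangential (hξ : ξ.IsAlt) {K Y : Submodule F V} (h : IsRegular ξ K)
    (hKY : K ≤ Y) (hd : finrank F K + 1 = finrank F Y) : IsTangential ξ Y := by
  have hlt : K < Y := lt_of_le_of_ne hKY (by rintro rfl; omega)
  obtain ⟨y, hy, hyK⟩ := Set.exists_of_ssubset hlt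
  -- Removing the component in K leaves a vector w of Y orthogonal to K; it spans the radical.
  obtain ⟨x, hx, w, hw, rfl⟩ := h.exists_add hξ y
  have hwY : w ∈ Y := (Submodule.add_mem_iff_right _ (hKY hx)).1 hy
  have hw0 : w ≠ 0 := by rintro rfl; exact hyK (by simpa using hx)
  rw [← sup_span_eq_of_finrank hKY hwY (h.notMem hw0 hw) hd]
  exact (h.hasRad_sup hξ hw0 hw).isTangential

theorem HasRad.exists_compl {U : Submodule F V} {p : V} (h : HasRad ξ U p) :
    ∃ K ≤ U, p ∉ K ∧ finrank F K + 1 = finrank F U := by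
  obtain ⟨C, hC⟩ := Submodule.exists_isCompl (Submodule.span F {p})
  have hp : p ∉ C := fun hm => h.1 (by
    have : p ∈ Submodule.span F {p} ⊓ C := ⟨Submodule.mem_span_singleton_self p, hm⟩
    simpa [hC.inf_eq_bot] using this)
  have hp' : p ∉ C ⊓ U := fun hm => hp hm.1
  refine ⟨C ⊓ U, inf_le_right, hp', ?_⟩
  rw [← Submodule.finrank_sup_span_singleton hp']
  have : Submodule.span F {p} ≤ U := (Submodule.span_singleton_le_iff_mem _ _).2 h.mem
  rw [sup_comm, ← sup_inf_assoc_of_le C this, hC.sup_eq_top, top_inf_eq]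

theorem finrank_inf_of_hyperplanes {B U W : Submodule F V} {k : ℕ} (hU : finrank F U = k)
    (hW : finrank F W = k) (hB : finrank F B = k + 1) (hUB : U ≤ B) (hWB : W ≤ B)
    (hne : U ≠ W) : finrank F (U ⊓ W : Submodule F V) + 1 = k := by
  have h1 := Submodule.finrank_sup_add_finrank_inf_eq U W
  have h2 := Submodule.finrank_mono (sup_le hUB hWB)
  have hlt : U < U ⊔ W := lt_of_le_of_ne le_sup_left fun e =>
    hne (Submodule.eq_of_le_of_finrank_eq (e ▸ le_sup_right : W ≤ U) (hW.trans hU.symm)).symm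
  have h3 := Submodule.finrank_lt_finrank_of_lt hlt
  omega

end Radicals

/-! ### Adjacency -/

section Adjacency

variable {F V : Type*} [Field F] [AddCommGroup V] [Module F V]
variable {ξ : LinearMap.BilinForm F V} {k : ℕ}

theorem BotAdj.symm {U W : Tang ξ k} (h : BotAdj ξ k U W) : BotAdj ξ k W U := by
  rwa [BotAdj, inf_comm]

theorem BotAdj.notMem {U W : Tang ξ k} {p : V} (hp : HasRad ξ U.1 p) (h : BotAdj ξ k U W) :
    p ∉ W.1 := fun hm =>
  hp.1 (isRegular_iff.1 h.2 p ⟨hp.mem, hm⟩ fun _ hy => hp.right hy.1)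

theorem BotAdj.ne {U W : Tang ξ k} (h : BotAdj ξ k U W) : U ≠ W := by
  rintro rfl
  obtain ⟨p, hp⟩ := U.2.2.exists_hasRad
  exact h.notMem hp hp.mem

/-- Coordinates in the span of two adjacent subspaces are unique. -/
theorem BotAdj.coord_eq_zero {U W : Tang ξ k} (h : BotAdj ξ k U W) {p q : V}
    (hp : HasRad ξ U.1 p) (hq : HasRad ξ W.1 q) {x : V} (hx : x ∈ U.1 ⊓ W.1) {a b : F}
    (e : x + a • p + b • q = 0) : x = 0 ∧ a = 0 ∧ b = 0 := by
  have hb : b = 0 := by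
    by_contra hb
    refine h.symm.notMem hq ((U.1.smul_mem_iff hb).1 ?_)
    rw [eq_neg_of_add_eq_zero_right e]
    exact U.1.neg_mem (U.1.add_mem hx.1 (U.1.smul_mem _ hp.mem))
  subst hb
  have ha : a = 0 := by
    by_contra ha
    refine h.notMem hp ((W.1.smul_mem_iff ha).1 ?_)
    rw [zero_smul, add_zero] at e
    rw [eq_neg_of_add_eq_zero_right e]
    exact W.1.neg_mem hx.2
  subst ha
  exact ⟨by simpa using e, rfl, rfl⟩

variable [FiniteDimensional F V]

theorem botAdj_of_finrank (hξ : ξ.IsAlt) {U W : Tang ξ k} {p : V} (hp : HasRad ξ U.1 p)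
    (hd : finrank F (U.1 ⊓ W.1 : Submodule F V) + 1 = k) (hpW : p ∉ W.1) : BotAdj ξ k U W :=
  ⟨hd, hp.isRegular_of_notMem hξ inf_le_left (fun h => hpW h.2) (hd.trans U.2.1.symm)⟩

/-- Inside a common (k + 1)-space the dimension condition is automatic, so adjacency only asks that
the radical of one subspace avoid the other. -/
theorem botAdj_of_hyperplanes (hξ : ξ.IsAlt) {U W : Tang ξ k} {p : V} (hp : HasRad ξ U.1 p)
    {B : Submodule F V} (hB : finrank F B = k + 1) (hUB : U.1 ≤ B) (hWB : W.1 ≤ B)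
    (hpW : p ∉ W.1) : BotAdj ξ k U W :=
  botAdj_of_finrank hξ hp (finrank_inf_of_hyperplanes U.2.1 W.2.1 hB hUB hWB
    fun e => hpW (e ▸ hp.mem)) hpW

theorem botAdj_of_regular {U W : Tang ξ k} {H : Submodule F V} (hH : IsRegular ξ H)
    (hd : finrank F H + 1 = k) (hU : H ≤ U.1) (hW : H ≤ W.1) (hne : U ≠ W) :
    BotAdj ξ k U W := by
  have hlt : U.1 ⊓ W.1 < U.1 := lt_of_le_of_ne inf_le_left fun e =>
    hne (Subtype.ext (Submodule.eq_of_le_of_finrank_eq (inf_eq_left.1 e)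
      (U.2.1.trans W.2.1.symm)))
  have h1 := Submodule.finrank_lt_finrank_of_lt hlt
  have h2 := Submodule.finrank_mono (le_inf hU hW)
  have h3 := U.2.1
  have e : H = U.1 ⊓ W.1 := Submodule.eq_of_le_of_finrank_le (le_inf hU hW) (by omega)
  exact ⟨e ▸ hd, e ▸ hH⟩

theorem BotAdj.finrank_sup {U W : Tang ξ k} (h : BotAdj ξ k U W) :
    finrank F (U.1 ⊔ W.1 : Submodule F V) = k + 1 := by
  have h1 := Submodule.finrank_sup_add_finrank_inf_eq U.1 W.1
  have := h.1
  have := U.2.1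
  have := W.2.1
  omega

theorem BotAdj.sup_eq {U W : Tang ξ k} (h : BotAdj ξ k U W) {p : V} (hp : HasRad ξ U.1 p) :
    U.1 ⊓ W.1 ⊔ Submodule.span F {p} = U.1 :=
  sup_span_eq_of_finrank inf_le_left hp.mem (fun hm => h.notMem hp hm.2) (h.1.trans U.2.1.symm)

/-- Among three pairwise adjacent subspaces, each pairwise intersection lies in the third one or
the third one lies in the sum of the other two. -/
theorem inf_le_or_le_sup {A B C : Tang ξ k} (hAB : BotAdj ξ k A B) (hA : BotAdj ξ k C A)
    (hB : BotAdj ξ k C B) : A.1 ⊓ B.1 ≤ C.1 ∨ C.1 ≤ A.1 ⊔ B.1 := by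
  -- The two intersections are hyperplanes of C: if equal, both coincide with A ∩ B; if distinct,
  -- they span C.
  by_cases e : C.1 ⊓ A.1 = C.1 ⊓ B.1
  · left
    have h1 : C.1 ⊓ A.1 ≤ A.1 ⊓ B.1 := le_inf inf_le_right (e ▸ inf_le_right)
    have h2 := Submodule.eq_of_le_of_finrank_le h1 (by have := hA.1; have := hAB.1; omega)
    exact h2 ▸ inf_le_left
  · right
    have h1 : C.1 ⊓ A.1 < C.1 ⊓ A.1 ⊔ C.1 ⊓ B.1 := lt_of_le_of_ne le_sup_left fun e' =>
      e (Submodule.eq_of_le_of_finrank_le (e' ▸ le_sup_right : C.1 ⊓ B.1 ≤ C.1 ⊓ A.1)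
        (by have := hA.1; have := hB.1; omega)).symm
    have h2 := Submodule.finrank_lt_finrank_of_lt h1
    have h3 : C.1 ⊓ A.1 ⊔ C.1 ⊓ B.1 = C.1 := Submodule.eq_of_le_of_finrank_le
      (sup_le inf_le_left inf_le_left) (by have := hA.1; have := C.2.1; omega)
    exact h3.symm.le.trans (sup_le_sup inf_le_right inf_le_right)

/-- The common neighbours of a triangle that does not lie in a `(k + 1)`-subspace form a
clique. -/
theorem eq_or_botAdj_of_not_le_sup {U W Z Y Y' : Tang ξ k} (hUW : BotAdj ξ k U W)
    (hZU : BotAdj ξ k Z U) (hZW : BotAdj ξ k Z W) (hZ : ¬ Z.1 ≤ U.1 ⊔ W.1)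
    (hYU : BotAdj ξ k Y U) (hYW : BotAdj ξ k Y W) (hYZ : BotAdj ξ k Y Z)
    (hYU' : BotAdj ξ k Y' U) (hYW' : BotAdj ξ k Y' W) (hYZ' : BotAdj ξ k Y' Z) :
    Y = Y' ∨ BotAdj ξ k Y Y' := by
  have hHZ : U.1 ⊓ W.1 ≤ Z.1 := (inf_le_or_le_sup hUW hZU hZW).resolve_right hZ
  have eH : U.1 ⊓ W.1 = U.1 ⊓ Z.1 := Submodule.eq_of_le_of_finrank_eq (le_inf inf_le_left hHZ)
    (by have := hUW.1; have := hZU.symm.1; omega)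
  -- A common neighbour not containing H = U ∩ W = U ∩ Z would lie in both U + W and U + Z, whose
  -- intersection is U.
  have key : ∀ T : Tang ξ k, BotAdj ξ k T U → BotAdj ξ k T W → BotAdj ξ k T Z →
      U.1 ⊓ W.1 ≤ T.1 := by
    intro T hTU hTW hTZ
    by_contra hT
    have h1 := (inf_le_or_le_sup hUW hTU hTW).resolve_left hT
    have h2 := (inf_le_or_le_sup hZU.symm hTU hTZ).resolve_left (eH ▸ hT)
    have hlt : (U.1 ⊔ W.1) ⊓ (U.1 ⊔ Z.1) < U.1 ⊔ W.1 := lt_of_le_of_ne inf_le_left fun e => by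
      have h3 : U.1 ⊔ W.1 = U.1 ⊔ Z.1 := Submodule.eq_of_le_of_finrank_eq (inf_eq_left.1 e)
        (hUW.finrank_sup.trans hZU.symm.finrank_sup.symm)
      exact hZ (h3 ▸ le_sup_right)
    have h3 := Submodule.finrank_lt_finrank_of_lt hlt
    have h4 : U.1 = (U.1 ⊔ W.1) ⊓ (U.1 ⊔ Z.1) :=
      Submodule.eq_of_le_of_finrank_le (le_inf le_sup_left le_sup_left)
        (by have := hUW.finrank_sup; have := U.2.1; omega)
    have h5 : T.1 ≤ U.1 := h4 ▸ le_inf h1 h2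
    exact hTU.ne (Subtype.ext (Submodule.eq_of_le_of_finrank_eq h5 (T.2.1.trans U.2.1.symm)))
  by_cases e : Y = Y'
  · exact .inl e
  · exact .inr (botAdj_of_regular hUW.2 hUW.1 (key Y hYU hYW hYZ) (key Y' hYU' hYW' hYZ') e)

theorem BotAdj.exists_coord {U W : Tang ξ k} (h : BotAdj ξ k U W) {p q : V}
    (hp : HasRad ξ U.1 p) (hq : HasRad ξ W.1 q) {v : V} (hv : v ∈ U.1 ⊔ W.1) :
    ∃ x ∈ U.1 ⊓ W.1, ∃ a b : F, v = x + a • p + b • q := by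
  obtain ⟨u, hu, w, hw, rfl⟩ := Submodule.mem_sup.1 hv
  rw [← h.sup_eq hp, mem_sup_span] at hu
  rw [← h.symm.sup_eq hq, mem_sup_span] at hw
  obtain ⟨x, hx, a, rfl⟩ := hu
  obtain ⟨y, hy, b, rfl⟩ := hw
  rw [inf_comm] at hy
  exact ⟨x + y, add_mem hx hy, a, b, by abel⟩

/-- Hyperplanes of the span of two adjacent subspaces `U`, `W` that contain `p - q`. -/
theorem BotAdj.exists_hyperplane (hξ : ξ.IsAlt) {U W : Tang ξ k} (h : BotAdj ξ k U W) {p q : V}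
    (hp : HasRad ξ U.1 p) (hq : HasRad ξ W.1 q) {g : V} (hg : g ∈ U.1 ⊓ W.1) :
    ∃ Y : Tang ξ k, Y.1 ≤ U.1 ⊔ W.1 ∧
      (∀ x ∈ U.1 ⊓ W.1, ∀ a b : F, x + a • p + b • q ∈ Y.1 ↔ a + b = ξ g x) ∧
      HasRad ξ Y.1 (p - q - ξ p q • g) := by
  set H := U.1 ⊓ W.1 with hH
  -- Y will be φ(H) + ⟨p - q⟩, where φ shears H along p. Since φ(H) is a hyperplane of U avoiding p,
  -- it is regular, and so Y is tangential.
  let φ : V →ₗ[F] V := LinearMap.id + (ξ g).smulRight p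
  have hφ : ∀ v, φ v = v + ξ g v • p := fun v => by simp [φ]
  have hgp : ξ g p = 0 := hp.right hg.1
  have hinj : Function.Injective φ := by
    rw [injective_iff_map_eq_zero]
    intro v hv
    rw [hφ] at hv
    have h1 : ξ g v = 0 := by
      have := congrArg (ξ g) hv
      simpa [hgp] using this
    simpa [h1] using hv
  have hfr : finrank F (H.map φ) = finrank F H :=
    (Submodule.equivMapOfInjective φ hinj H).finrank_eq.symm
  have hKU : H.map φ ≤ U.1 := by
    rintro _ ⟨x, hx, rfl⟩
    rw [hφ]
    exact U.1.add_mem hx.1 (U.1.smul_mem _ hp.mem)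
  have hmem : ∀ x ∈ H, ∀ a b : F, x + a • p + b • q ∈ H.map φ ⊔ Submodule.span F {p - q} ↔
      a + b = ξ g x := by
    intro x hx a b
    rw [mem_sup_span]
    constructor
    · rintro ⟨_, ⟨y, hy, rfl⟩, t, e⟩
      rw [hφ] at e
      obtain ⟨e1, e2, e3⟩ := h.coord_eq_zero hp hq (x := y - x) (a := ξ g y + t - a)
        (b := - t - b) (sub_mem hy hx) (by
          rw [← sub_eq_zero] at e
          rw [← e]
          module)
      rw [sub_eq_zero] at e1
      subst e1
      linear_combination -e2 - e3
    · intro e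
      refine ⟨φ x, ⟨x, hx, rfl⟩, -b, ?_⟩
      rw [hφ, ← e]
      module
  have hpK : p ∉ H.map φ := fun hm => by
    have := (hmem 0 H.zero_mem 1 0).1 (by simpa using Submodule.mem_sup_left hm)
    simp at this
  have hpq : p - q ∉ H.map φ := fun hm => by
    refine h.symm.notMem hq ?_
    have := U.1.sub_mem hp.mem (hKU hm)
    simpa using this
  have hK1 : finrank F (H.map φ) + 1 = finrank F U.1 := by rw [hfr, h.1, U.2.1]
  have hreg := hp.isRegular_of_notMem hξ hKU hpK hK1
  have hd : finrank F (H.map φ ⊔ Submodule.span F {p - q} : Submodule F V) =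
      finrank F (H.map φ) + 1 := Submodule.finrank_sup_span_singleton hpq
  have htan := hreg.isTangential hξ (Y := H.map φ ⊔ Submodule.span F {p - q}) le_sup_left hd.symm
  refine ⟨⟨_, by rw [hd, hK1, U.2.1], htan⟩, ?_, hmem, ?_⟩
  · refine sup_le (hKU.trans le_sup_left) ((Submodule.span_singleton_le_iff_mem _ _).2 ?_)
    exact sub_mem (Submodule.mem_sup_left hp.mem) (Submodule.mem_sup_right hq.mem)
  · have hgq : ξ g q = 0 := hq.right hg.2
    refine HasRad.of_mem htan (fun e => ?_) ?_ fun u hu => ?_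
    · obtain ⟨-, h1, -⟩ := h.coord_eq_zero hp hq (x := - (ξ p q • g)) (a := 1) (b := -1)
        (neg_mem (H.smul_mem _ hg)) (by rw [← e]; module)
      exact one_ne_zero h1
    · have := (hmem (- (ξ p q • g)) (neg_mem (H.smul_mem _ hg)) 1 (-1)).2
        (by simp [hξ.self_eq_zero])
      convert! this using 1
      module
    · rw [mem_sup_span] at hu
      obtain ⟨_, ⟨y, hy, rfl⟩, t, rfl⟩ := hu
      have h1 : ξ y p = 0 := hp.right hy.1
      have h2 : ξ y q = 0 := hq.right hy.2
      have h3 : ξ p g = 0 := hp.left hξ hg.1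
      have h4 : ξ q g = 0 := hq.left hξ hg.2
      have h5 : ξ y g = - ξ g y := (LinearMap.IsAlt.neg hξ g y).symm
      have h6 : ξ q p = - ξ p q := (LinearMap.IsAlt.neg hξ p q).symm
      rw [hφ]
      simp only [map_add, map_sub, map_smul, LinearMap.add_apply, LinearMap.smul_apply,
        LinearMap.sub_apply, hξ.self_eq_zero, smul_eq_mul, h1, h2, h3, h4, h5, h6]
      ring

end Adjacency

/-! ### Triangles, and what non-adjacency says about radicals -/

section Triangles

variable {F V : Type*} [Field F] [AddCommGroup V] [Module F V] [FiniteDimensional F V]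
variable {ξ : LinearMap.BilinForm F V} {k : ℕ}

theorem botAdj_iff_notMem (hξ : ξ.IsAlt) {U W : Tang ξ k} {p : V} (hp : HasRad ξ U.1 p)
    {B : Submodule F V} (hB : finrank F B = k + 1) (hUB : U.1 ≤ B) (hWB : W.1 ≤ B) :
    BotAdj ξ k U W ↔ p ∉ W.1 :=
  ⟨fun h => h.notMem hp, botAdj_of_hyperplanes hξ hp hB hUB hWB⟩

/-- `Z` is adjacent to `U` and `W` and lies in their sum. -/
def SumTriangle (ξ : LinearMap.BilinForm F V) (k : ℕ) (U W Z : Tang ξ k) : Prop :=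
  BotAdj ξ k Z U ∧ BotAdj ξ k Z W ∧ Z.1 ≤ U.1 ⊔ W.1

/-- The third vertex meets the line joining the radicals of the other two in a third point. -/
theorem SumTriangle.exists_sub_smul_mem {U W Z : Tang ξ k} (h : BotAdj ξ k U W)
    (hZ : SumTriangle ξ k U W Z) {p q : V} (hp : HasRad ξ U.1 p) (hq : HasRad ξ W.1 q) :
    ∃ t : F, t ≠ 0 ∧ p - t • q ∈ Z.1 := by
  have hqZ : q ∉ Z.1 := hZ.2.1.symm.notMem hq
  have hpZ : p ∉ Z.1 := hZ.1.symm.notMem hp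
  have e := sup_span_eq_of_finrank hZ.2.2 (Submodule.mem_sup_right hq.mem) hqZ
    (by rw [h.finrank_sup, Z.2.1])
  have hpB : p ∈ U.1 ⊔ W.1 := Submodule.mem_sup_left hp.mem
  rw [← e, mem_sup_span] at hpB
  obtain ⟨x, hx, t, rfl⟩ := hpB
  refine ⟨t, ?_, by simpa using hx⟩
  rintro rfl
  exact hpZ (by simpa using hx)

/-- In the span of two adjacent subspaces, a triangle has two common neighbours that are neither
equal nor adjacent. -/
theorem SumTriangle.exists_not_botAdj (hξ : ξ.IsAlt) (h2 : (2 : F) ≠ 0) (hk : 3 ≤ k)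
    {U W Z : Tang ξ k} (h : BotAdj ξ k U W) (hZ : SumTriangle ξ k U W Z) :
    ∃ Y Y' : Tang ξ k, (BotAdj ξ k Y U ∧ BotAdj ξ k Y W ∧ BotAdj ξ k Y Z) ∧
      (BotAdj ξ k Y' U ∧ BotAdj ξ k Y' W ∧ BotAdj ξ k Y' Z) ∧ Y ≠ Y' ∧ ¬ BotAdj ξ k Y Y' := by
  obtain ⟨p, hp⟩ := U.2.2.exists_hasRad
  obtain ⟨q₀, hq₀⟩ := W.2.2.exists_hasRad
  obtain ⟨t, ht, hpq₀⟩ := hZ.exists_sub_smul_mem h hp hq₀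
  -- Rescaling q makes the third point p + q, while the hyperplanes built below contain p - q; these
  -- are different points because 2 ≠ 0.
  obtain ⟨q, hq, hpq⟩ : ∃ q, HasRad ξ W.1 q ∧ p + q ∈ Z.1 :=
    ⟨(-t) • q₀, hq₀.smul (neg_ne_zero.2 ht), by rwa [neg_smul, ← sub_eq_add_neg]⟩
  obtain ⟨z, hz⟩ := Z.2.2.exists_hasRad
  obtain ⟨x, hx, a, b, rfl⟩ := h.exists_coord hp hq (hZ.2.2 hz.mem)
  have hzU := hZ.1.notMem hz
  have hzW := hZ.2.1.notMem hz
  have hb : b ≠ 0 := by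
    rintro rfl
    exact hzU (by simpa using add_mem hx.1 (U.1.smul_mem a hp.mem))
  have hxp : ξ x p = 0 := hp.right hx.1
  have hxq : ξ x q = 0 := hq.right hx.2
  have hqp : ξ q p = - ξ p q := (LinearMap.IsAlt.neg hξ p q).symm
  -- If p ⊥ q, then p + q is orthogonal to all of U + W and so spans Rad Z. Otherwise ξ(z, p + q) =
  -- (a - b) ξ(p, q) must vanish.
  have hab : a = b := by
    by_cases hc : ξ p q = 0
    · obtain ⟨s, hs⟩ := hz.exists_smul hpq fun u hu => by
        obtain ⟨y, hy, c, d, rfl⟩ := h.exists_coord hp hq (hZ.2.2 hu)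
        simp [hp.right hy.1, hq.right hy.2, hc, hqp, hξ.self_eq_zero]
      obtain ⟨-, e1, e2⟩ := h.coord_eq_zero hp hq (x := s • x) (a := s * a - 1)
        (b := s * b - 1) (Submodule.smul_mem _ _ hx) (by
          rw [← sub_eq_zero] at hs
          rw [← hs]
          module)
      have hs0 : s ≠ 0 := by
        rintro rfl
        simp at e1
      exact mul_left_cancel₀ hs0 (by linear_combination e1 - e2)
    · have := hz.left hξ hpq
      simp only [map_add, map_smul, LinearMap.add_apply, LinearMap.smul_apply, hξ.self_eq_zero,
        smul_eq_mul, hxp, hxq, hqp] at this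
      refine mul_right_cancel₀ hc ?_
      linear_combination this
  subst hab
  -- The vector x itself serves unless it is zero; then any nonzero g does, and one exists since dim
  -- (U ∩ W) = k - 1 ≥ 2.
  obtain ⟨g, hg, hg0, hgx⟩ : ∃ g ∈ U.1 ⊓ W.1, g ≠ 0 ∧ ξ g x = 0 := by
    by_cases hx0 : x = 0
    · subst hx0
      have : U.1 ⊓ W.1 ≠ ⊥ := fun e => by
        have := h.1
        rw [e, finrank_bot] at this
        omega
      obtain ⟨g, hg, hg0⟩ := Submodule.exists_mem_ne_zero_of_ne_bot this
      exact ⟨g, hg, hg0, by simp⟩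
    · exact ⟨x, hx, hx0, hξ.self_eq_zero x⟩
  have key : ∀ g ∈ U.1 ⊓ W.1, ξ g x = 0 → ∃ Y : Tang ξ k,
      (∀ x ∈ U.1 ⊓ W.1, ∀ a b : F, x + a • p + b • q ∈ Y.1 ↔ a + b = ξ g x) ∧
      (BotAdj ξ k Y U ∧ BotAdj ξ k Y W ∧ BotAdj ξ k Y Z) ∧
      HasRad ξ Y.1 (p - q - ξ p q • g) := by
    intro g hg hgx
    obtain ⟨Y, hYB, hY, hYr⟩ := h.exists_hyperplane hξ hp hq hg
    refine ⟨Y, hY, ⟨?_, ?_, ?_⟩, hYr⟩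
    · refine (botAdj_of_hyperplanes hξ hp h.finrank_sup le_sup_left hYB fun hm => ?_).symm
      have := (hY 0 (zero_mem _) 1 0).1 (by simpa using hm)
      simp at this
    · refine (botAdj_of_hyperplanes hξ hq h.finrank_sup le_sup_right hYB fun hm => ?_).symm
      have := (hY 0 (zero_mem _) 0 1).1 (by simpa using hm)
      simp at this
    -- Membership of z = x + a p + a q in Y would mean 2a = ξ(g, x) = 0.
    · refine (botAdj_of_hyperplanes hξ hz h.finrank_sup hZ.2.2 hYB fun hm => ?_).symm
      have := (hY x hx a a).1 hm
      rw [hgx, ← two_mul] at this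
      exact mul_ne_zero h2 hb this
  obtain ⟨Y, hY, hYadj, hYr⟩ := key 0 (zero_mem _) (by simp)
  obtain ⟨Y', hY', hYadj', -⟩ := key g hg hgx
  refine ⟨Y, Y', hYadj, hYadj', ?_, fun hadj => ?_⟩
  · rintro rfl
    refine hg0 (isRegular_iff.1 h.2 g hg fun y hy => ?_)
    have h1 := (hY y hy 0 0).2 (by simp)
    have h2 := (hY' y hy 0 0).1 h1
    exact hξ.isRefl _ _ (by simpa using h2.symm)
  -- The radical p - q of the hyperplane for g = 0 lies in every hyperplane of the family.
  · refine hadj.notMem hYr ?_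
    have := (hY' 0 (zero_mem _) 1 (-1)).2 (by simp)
    convert! this using 1
    module

/-- Adjacency with orthogonal radicals. -/
def OrthAdj (ξ : LinearMap.BilinForm F V) (k : ℕ) (U W : Tang ξ k) : Prop :=
  BotAdj ξ k U W ∧ Perp ξ (rad ξ U.1) (rad ξ W.1)

/-- In a non-regular sum, radicals are points of the line joining the radicals. -/
theorem SumTriangle.hasRad_sub (hξ : ξ.IsAlt) {U W X : Tang ξ k} (h : BotAdj ξ k U W)
    (hX : SumTriangle ξ k U W X) {p q : V} (hp : HasRad ξ U.1 p) (hq : HasRad ξ W.1 q)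
    (hpq : ξ p q = 0) {t : F} (ht : p - t • q ∈ X.1) : HasRad ξ X.1 (p - t • q) := by
  refine HasRad.of_mem X.2.2 (fun e => ?_) ht fun u hu => ?_
  · obtain ⟨-, h1, -⟩ := h.coord_eq_zero hp hq (x := 0) (a := 1) (b := -t) (zero_mem _)
      (by simpa [sub_eq_add_neg] using e)
    exact one_ne_zero h1
  · obtain ⟨y, hy, c, d, rfl⟩ := h.exists_coord hp hq (hX.2.2 hu)
    simp [hp.right hy.1, hq.right hy.2, hpq, hξ.self_eq_zero, hξ.isRefl _ _ hpq]

/-- Rad X is a point p - t q of the line pq. Non-adjacency puts it into Y, and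
`SumTriangle.hasRad_sub` then identifies it with Rad Y. -/
theorem SumTriangle.rad_eq_of_not_botAdj (hξ : ξ.IsAlt) {U W X Y : Tang ξ k}
    (h : OrthAdj ξ k U W) (hX : SumTriangle ξ k U W X) (hY : SumTriangle ξ k U W Y)
    (hXY : ¬ BotAdj ξ k X Y) : rad ξ X.1 = rad ξ Y.1 := by
  obtain ⟨p, hp⟩ := U.2.2.exists_hasRad
  obtain ⟨q, hq⟩ := W.2.2.exists_hasRad
  have hpq := (hp.perp_iff hq).1 h.2
  obtain ⟨t, -, ht⟩ := hX.exists_sub_smul_mem h.1 hp hq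
  have hXr := hX.hasRad_sub hξ h.1 hp hq hpq ht
  have hm : p - t • q ∈ Y.1 := by
    by_contra hm
    exact hXY (botAdj_of_hyperplanes hξ hXr h.1.finrank_sup hX.2.2 hY.2.2 hm)
  rw [hXr.2, (hY.hasRad_sub hξ h.1 hp hq hpq hm).2]

/-- Orthogonality of the radicals of adjacent subspaces in terms of adjacency. -/
theorem orthAdj_iff (hξ : ξ.IsAlt) (hk : 3 ≤ k) {U W : Tang ξ k} :
    OrthAdj ξ k U W ↔ BotAdj ξ k U W ∧ ∀ X Y Z, SumTriangle ξ k U W X → SumTriangle ξ k U W Y →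
      SumTriangle ξ k U W Z → ¬ BotAdj ξ k X Y → ¬ BotAdj ξ k Y Z → ¬ BotAdj ξ k X Z := by
  constructor
  · refine fun h => ⟨h.1, fun X Y Z hX hY hZ h1 h2 h3 => ?_⟩
    have e := (hX.rad_eq_of_not_botAdj hξ h hY h1).trans (hY.rad_eq_of_not_botAdj hξ h hZ h2)
    obtain ⟨x, hx⟩ := X.2.2.exists_hasRad
    exact h3.notMem hx (hx.of_iff e.symm).mem
  · rintro ⟨h, H⟩
    refine ⟨h, ?_⟩
    obtain ⟨p, hp⟩ := U.2.2.exists_hasRad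
    obtain ⟨q, hq⟩ := W.2.2.exists_hasRad
    rw [hp.perp_iff hq]
    by_contra hpq
    -- With ξ(p, q) ≠ 0 the radicals p - q - ξ(p, q) g vary with g. The hyperplane for 0 is
    -- non-adjacent to those for g and g', while these two are adjacent as soon as ξ(g', g) ≠ 0.
    have key : ∀ g ∈ U.1 ⊓ W.1, ∃ Y : Tang ξ k, SumTriangle ξ k U W Y ∧
        (∀ x ∈ U.1 ⊓ W.1, ∀ a b : F, x + a • p + b • q ∈ Y.1 ↔ a + b = ξ g x) ∧
        HasRad ξ Y.1 (p - q - ξ p q • g) := by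
      intro g hg
      obtain ⟨Y, hYB, hY, hYr⟩ := h.exists_hyperplane hξ hp hq hg
      refine ⟨Y, ⟨?_, ?_, hYB⟩, hY, hYr⟩
      · refine (botAdj_of_hyperplanes hξ hp h.finrank_sup le_sup_left hYB fun hm => ?_).symm
        have := (hY 0 (zero_mem _) 1 0).1 (by simpa using hm)
        simp at this
      · refine (botAdj_of_hyperplanes hξ hq h.finrank_sup le_sup_right hYB fun hm => ?_).symm
        have := (hY 0 (zero_mem _) 0 1).1 (by simpa using hm)
        simp at this
    obtain ⟨g, hg, hg0⟩ : ∃ g ∈ U.1 ⊓ W.1, g ≠ 0 := by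
      have : U.1 ⊓ W.1 ≠ ⊥ := fun e => by
        have := h.1
        rw [e, finrank_bot] at this
        omega
      exact Submodule.exists_mem_ne_zero_of_ne_bot this
    obtain ⟨g', hg', hgg⟩ : ∃ g' ∈ U.1 ⊓ W.1, ξ g' g ≠ 0 := by
      by_contra! hcon
      exact hg0 (isRegular_iff.1 h.2 g hg hcon)
    obtain ⟨X, hX, hXm, hXr⟩ := key g hg
    obtain ⟨Y, hY, hYm, hYr⟩ := key 0 (zero_mem _)
    obtain ⟨Z, hZ, hZm, hZr⟩ := key g' hg'
    have mem : ∀ g ∈ U.1 ⊓ W.1, ∀ T : Tang ξ k,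
        (∀ x ∈ U.1 ⊓ W.1, ∀ a b : F, x + a • p + b • q ∈ T.1 ↔ a + b = ξ g x) →
        p - q - ξ p q • (0 : V) ∈ T.1 := by
      intro g hg T hT
      have := (hT 0 (zero_mem _) 1 (-1)).2 (by simp)
      convert! this using 1
      module
    refine H X Y Z hX hY hZ (fun hadj => hadj.symm.notMem hYr (mem g hg X hXm))
      (fun hadj => hadj.notMem hYr (mem g' hg' Z hZm)) ?_
    refine botAdj_of_hyperplanes hξ hXr h.finrank_sup hX.2.2 hZ.2.2 fun hm => ?_
    have := (hZm (-(ξ p q • g)) (neg_mem (Submodule.smul_mem _ _ hg)) 1 (-1)).1 (by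
      convert! hm using 1
      module)
    simp [hpq, hgg] at this

/-- Equal radicals and an intersection of codimension at most one. -/
def RadAdj (ξ : LinearMap.BilinForm F V) (k : ℕ) (U W : Tang ξ k) : Prop :=
  rad ξ U.1 = rad ξ W.1 ∧ k ≤ finrank F (U.1 ⊓ W.1 : Submodule F V) + 1

/-- For distinct Y, Y' with common radical ⟨r⟩, take a complement H of r in Y and a vector w
orthogonal to H and r with Y' ≤ H + ⟨r, w⟩. Then U = H + ⟨w⟩ and W = H + ⟨w + r⟩ are the required
pair. The converse is `SumTriangle.rad_eq_of_not_botAdj` and a dimension count in U + W. -/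
theorem radAdj_iff (hξ : ξ.IsAlt) {Y Y' : Tang ξ k} :
    RadAdj ξ k Y Y' ↔ Y = Y' ∨ ∃ U W, OrthAdj ξ k U W ∧ SumTriangle ξ k U W Y ∧
      SumTriangle ξ k U W Y' ∧ ¬ BotAdj ξ k Y Y' := by
  constructor
  · rintro ⟨hr, hd⟩
    refine or_iff_not_imp_left.2 fun hne => ?_
    have hlt : Y.1 ⊓ Y'.1 < Y'.1 := lt_of_le_of_ne inf_le_right fun e =>
      hne (Subtype.ext (Submodule.eq_of_le_of_finrank_eq (inf_eq_right.1 e)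
        (Y'.2.1.trans Y.2.1.symm))).symm
    have hd' : finrank F (Y.1 ⊓ Y'.1 : Submodule F V) + 1 = k := by
      have := Submodule.finrank_lt_finrank_of_lt hlt
      have := Y'.2.1
      omega
    obtain ⟨y, hy, hyY⟩ := Set.exists_of_ssubset hlt
    obtain ⟨r, hY⟩ := Y.2.2.exists_hasRad
    have hY' : HasRad ξ Y'.1 r := hY.of_iff hr.symm
    obtain ⟨H, hHY, hrH, hHd⟩ := hY.exists_compl
    have hH := hY.isRegular_of_notMem hξ hHY hrH hHd
    rw [Y.2.1] at hHd
    obtain ⟨x, hx, w, hw, rfl⟩ := hH.exists_add hξ y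
    have hwY : w ∉ Y.1 := fun hm => hyY ⟨add_mem (hHY hx) hm, hy⟩
    have hw0 : w ≠ 0 := by rintro rfl; exact hwY (zero_mem _)
    have hwr : ξ w r = 0 := by
      have := hY'.right hy
      simpa [hY.right (hHY hx)] using this
    have hrw : ξ r w = 0 := hξ.isRefl _ _ hwr
    have hw' : ∀ y ∈ H, ξ y (w + r) = 0 := fun y hy => by simp [hw y hy, hY.right (hHY hy)]
    have hwr0 : w + r ≠ 0 := fun e => hwY (by
      rw [eq_neg_of_add_eq_zero_left e]; exact neg_mem hY.mem)
    obtain ⟨U, eU⟩ : ∃ U : Tang ξ k, U.1 = H ⊔ Submodule.span F {w} :=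
      ⟨⟨_, by rw [hH.finrank_sup hw0 hw, hHd], (hH.hasRad_sup hξ hw0 hw).isTangential⟩, rfl⟩
    obtain ⟨W, eW⟩ : ∃ W : Tang ξ k, W.1 = H ⊔ Submodule.span F {w + r} :=
      ⟨⟨_, by rw [hH.finrank_sup hwr0 hw', hHd], (hH.hasRad_sup hξ hwr0 hw').isTangential⟩, rfl⟩
    have hU : HasRad ξ U.1 w := eU ▸ hH.hasRad_sup hξ hw0 hw
    have hW : HasRad ξ W.1 (w + r) := eW ▸ hH.hasRad_sup hξ hwr0 hw'
    have hHU : H ≤ U.1 := eU ▸ le_sup_left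
    have hHW : H ≤ W.1 := eW ▸ le_sup_left
    have hUW : BotAdj ξ k U W := botAdj_of_regular hH hHd hHU hHW fun e => by
      have h1 : r ∈ U.1 := by
        have := U.1.sub_mem (e ▸ hW.mem : w + r ∈ U.1) hU.mem
        simpa using this
      rw [eU, mem_sup_span] at h1
      obtain ⟨h, hh, t, e⟩ := h1
      by_cases ht : t = 0
      · subst ht
        exact hrH (by rw [← e]; simpa using hh)
      · refine hwY ((Y.1.smul_mem_iff ht).1 ?_)
        rw [eq_sub_of_add_eq' e]
        exact sub_mem hY.mem (hHY hh)
    have hYU : BotAdj ξ k Y U := botAdj_of_regular hH hHd hHY hHU fun e => hwY (e ▸ hU.mem)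
    have hYW : BotAdj ξ k Y W := botAdj_of_regular hH hHd hHY hHW fun e => hwY (by
      have := Y.1.sub_mem (e ▸ hW.mem : w + r ∈ Y.1) hY.mem
      simpa using this)
    have hwB : w ∈ U.1 ⊔ W.1 := Submodule.mem_sup_left hU.mem
    have hrB : r ∈ U.1 ⊔ W.1 := by
      have := Submodule.sub_mem _ (Submodule.mem_sup_right hW.mem : w + r ∈ U.1 ⊔ W.1) hwB
      simpa using this
    have hYB : Y.1 ≤ U.1 ⊔ W.1 := by
      rw [← sup_span_eq_of_finrank hHY hY.mem hrH (hHd.trans Y.2.1.symm)]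
      exact sup_le (hHU.trans le_sup_left) ((Submodule.span_singleton_le_iff_mem _ _).2 hrB)
    have hYB' : Y'.1 ≤ U.1 ⊔ W.1 := by
      rw [← sup_span_eq_of_finrank inf_le_right hy hyY (hd'.trans Y'.2.1.symm)]
      refine sup_le (inf_le_left.trans hYB) ((Submodule.span_singleton_le_iff_mem _ _).2 ?_)
      exact add_mem (Submodule.mem_sup_left (hHU hx)) hwB
    have hB := sup_span_eq_of_finrank hYB hwB hwY (by rw [Y.2.1, hUW.finrank_sup])
    -- The vector w is orthogonal to H, r and itself, hence to U + W; inside Y' it would be a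
    -- multiple of r, contrary to w ∉ Y.
    have hwY' : w ∉ Y'.1 := fun hm => by
      obtain ⟨t, rfl⟩ := hY'.exists_smul hm fun u hu => by
        have := hYB' hu
        rw [← hB, mem_sup_span] at this
        obtain ⟨y, hy, t, rfl⟩ := this
        rw [← sup_span_eq_of_finrank hHY hY.mem hrH (hHd.trans Y.2.1.symm), mem_sup_span] at hy
        obtain ⟨h, hh, s, rfl⟩ := hy
        simp [hw h hh, hrw, hξ.self_eq_zero]
      exact hwY (Y.1.smul_mem _ hY.mem)
    refine ⟨U, W, ⟨hUW, ?_⟩, ⟨hYU, hYW, hYB⟩, ⟨?_, ?_, hYB'⟩, fun h => h.notMem hY hY'.mem⟩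
    · rw [hU.perp_iff hW]
      simp [hwr, hξ.self_eq_zero]
    · exact (botAdj_of_hyperplanes hξ hU hUW.finrank_sup le_sup_left hYB' hwY').symm
    · refine (botAdj_of_hyperplanes hξ hW hUW.finrank_sup le_sup_right hYB' fun hm => ?_).symm
      have := Y'.1.sub_mem hm hY'.mem
      exact hwY' (by simpa using this)
  · rintro (rfl | ⟨U, W, h, hY, hY', hn⟩)
    · exact ⟨rfl, by rw [inf_idem, Y.2.1]; omega⟩
    · refine ⟨hY.rad_eq_of_not_botAdj hξ h hY' hn, ?_⟩
      have h1 := Submodule.finrank_sup_add_finrank_inf_eq Y.1 Y'.1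
      have h2 := Submodule.finrank_mono (sup_le hY.2.2 hY'.2.2)
      have := h.1.finrank_sup
      have := Y.2.1
      have := Y'.2.1
      omega

end Triangles

/-! ### Subspaces with the same radical -/

section SameRadical

variable {F V : Type*} [Field F] [AddCommGroup V] [Module F V] [FiniteDimensional F V]
variable {ξ : LinearMap.BilinForm F V} {k : ℕ}

/-- `b` is reached from `a` in `n` steps of `R`. -/
def StepRel {M : Type*} (R : M → M → Prop) : ℕ → M → M → Prop
  | 0 => fun a b => a = b
  | n + 1 => fun a b => ∃ c, R a c ∧ StepRel R n c b

/-- The tangential subspace `(m^⊥ ⊓ U) ⊔ ⟨x⟩`. -/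
theorem HasRad.exists_exchange (hξ : ξ.IsAlt) {U : Tang ξ k} {r m x : V} (hU : HasRad ξ U.1 r)
    (hm : m ∈ U.1) (hxr : ξ x r = 0) (hmx : ξ m x ≠ 0) :
    ∃ X : Tang ξ k, HasRad ξ X.1 r ∧ RadAdj ξ k U X ∧ x ∈ X.1 ∧
      ∀ u ∈ U.1, ξ m u = 0 → u ∈ X.1 := by
  set K := LinearMap.ker (ξ m) ⊓ U.1 with hK
  have hmK : ∀ u, u ∈ K ↔ ξ m u = 0 ∧ u ∈ U.1 := fun u => by
    rw [hK, Submodule.mem_inf, LinearMap.mem_ker]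
  obtain ⟨u₀, hu₀, hmu⟩ : ∃ u₀ ∈ U.1, ξ m u₀ ≠ 0 := by
    by_contra! hcon
    obtain ⟨t, rfl⟩ := hU.exists_smul hm fun u hu => hξ.isRefl _ _ (hcon u hu)
    exact hmx (by simp [hξ.isRefl _ _ hxr])
  have hu₀K : u₀ ∉ K := fun h => hmu ((hmK _).1 h).1
  have hKd : finrank F K + 1 = k := by
    rw [← U.2.1, ← Submodule.finrank_sup_span_singleton hu₀K]
    refine congrArg (fun S : Submodule F V => finrank F S) (le_antisymm (sup_le inf_le_right
      ((Submodule.span_singleton_le_iff_mem _ _).2 hu₀)) fun u hu => ?_)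
    rw [mem_sup_span]
    refine ⟨u - (ξ m u / ξ m u₀) • u₀, (hmK _).2 ⟨?_, ?_⟩, ξ m u / ξ m u₀, by abel⟩
    · simp [div_mul_cancel₀ _ hmu]
    · exact sub_mem hu (U.1.smul_mem _ hu₀)
  have hxK : x ∉ K := fun h => hmx ((hmK _).1 h).1
  have hXd : finrank F (K ⊔ Submodule.span F {x} : Submodule F V) = k := by
    rw [Submodule.finrank_sup_span_singleton hxK, hKd]
  have hrX : HasRad ξ (K ⊔ Submodule.span F {x}) r := by
    refine ⟨hU.1, le_antisymm (fun v hv => ?_)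
      ((Submodule.span_singleton_le_iff_mem _ _).2 ⟨?_, fun u hu => ?_⟩)⟩
    · obtain ⟨a, ha, t, rfl⟩ := mem_sup_span.1 hv.1
      have ha' := (hmK _).1 ha
      have ht : t = 0 := by
        have := hv.2 m (Submodule.mem_sup_left ((hmK _).2 ⟨hξ.self_eq_zero m, hm⟩))
        simpa [ha'.1, hmx] using this
      subst ht
      rw [zero_smul, add_zero] at hv ⊢
      -- Here a ∈ m^⊥ ∩ U is orthogonal to m^⊥ ∩ U. Subtracting μ m makes it orthogonal to u₀ too,
      -- hence to U, so a - μ m is a multiple of r. Pairing with x, which is orthogonal to a and r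
      -- but not to m, gives μ = 0.
      set μ := ξ u₀ a / ξ u₀ m with hμ
      have hum : ξ u₀ m ≠ 0 := fun h => hmu (hξ.isRefl _ _ h)
      obtain ⟨s, hs⟩ := hU.exists_smul (x := a - μ • m) (sub_mem ha'.2 (U.1.smul_mem _ hm))
        fun u hu => by
          have hdec : u - (ξ m u / ξ m u₀) • u₀ ∈ K := (hmK _).2
            ⟨by simp [div_mul_cancel₀ _ hmu], sub_mem hu (U.1.smul_mem _ hu₀)⟩
          have h1 : ξ (u - (ξ m u / ξ m u₀) • u₀) a = 0 := hv.2 _ (Submodule.mem_sup_left hdec)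
          have h2 : ξ (u - (ξ m u / ξ m u₀) • u₀) m = 0 :=
            hξ.isRefl _ _ ((hmK _).1 hdec).1
          have h3 : ξ u₀ (a - μ • m) = 0 := by simp [hμ, div_mul_cancel₀ _ hum]
          have h4 : ξ (u - (ξ m u / ξ m u₀) • u₀) (a - μ • m) = 0 := by
            rw [map_sub, map_smul, h1, h2]; simp
          simpa [h3] using h4
      have h5 : ξ x a = 0 := hv.2 x (mem_sup_span.2 ⟨0, zero_mem _, 1, by simp⟩)
      have h6 : μ = 0 := by
        have := congrArg (ξ x) hs
        simp only [map_smul, map_sub, hxr, h5, smul_eq_mul, mul_zero, zero_sub] at this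
        have h7 : ξ x m ≠ 0 := fun h => hmx (hξ.isRefl _ _ h)
        simpa [h7] using this.symm
      exact Submodule.mem_span_singleton.2 ⟨s, by simpa [h6] using hs⟩
    · exact Submodule.mem_sup_left ((hmK _).2 ⟨hU.right hm, hU.mem⟩)
    · obtain ⟨a, ha, t, rfl⟩ := mem_sup_span.1 hu
      simp [hU.right ((hmK _).1 ha).2, hxr]
  refine ⟨⟨_, hXd, hrX.isTangential⟩, hrX, ⟨hU.2.trans hrX.2.symm, ?_⟩,
    mem_sup_span.2 ⟨0, zero_mem _, 1, by simp⟩, fun u hu h =>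
      Submodule.mem_sup_left ((hmK _).2 ⟨h, hu⟩)⟩
  have : finrank F K ≤ finrank F (U.1 ⊓ (K ⊔ Submodule.span F {x}) : Submodule F V) :=
    Submodule.finrank_mono (le_inf inf_le_right le_sup_left)
  change k ≤ finrank F (U.1 ⊓ (K ⊔ Submodule.span F {x}) : Submodule F V) + 1
  omega

/-- Double orthogonality relative to U: (I^⊥ ∩ U)^⊥ = I + U^⊥, and this meets U in I + Rad U = I. -/
theorem HasRad.mem_of_orthogonal (hξ : ξ.IsAlt) (hnd : ξ.Nondegenerate) {U I : Submodule F V}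
    {r x : V} (hU : HasRad ξ U r) (hI : I ≤ U) (hr : r ∈ I) (hx : x ∈ U)
    (h : ∀ m ∈ U, (∀ i ∈ I, ξ i m = 0) → ξ m x = 0) : x ∈ I := by
  have hx' : x ∈ ξ.orthogonal (ξ.orthogonal (I ⊔ ξ.orthogonal U)) := by
    intro m hm
    refine h m ?_ fun i hi => hm i (Submodule.mem_sup_left hi)
    rw [← LinearMap.BilinForm.orthogonal_orthogonal hnd hξ.isRefl U]
    exact fun y hy => hm y (Submodule.mem_sup_right hy)
  rw [LinearMap.BilinForm.orthogonal_orthogonal hnd hξ.isRefl] at hx'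
  obtain ⟨i, hi, y, hy, rfl⟩ := Submodule.mem_sup.1 hx'
  have hyU : y ∈ U := (Submodule.add_mem_iff_right _ (hI hi)).1 hx
  obtain ⟨t, rfl⟩ := hU.exists_smul hyU hy
  exact add_mem hi (I.smul_mem _ hr)

theorem HasRad.exists_orthogonal (hξ : ξ.IsAlt) (hnd : ξ.Nondegenerate) {U I : Submodule F V}
    {r : V} (hU : HasRad ξ U r) (hI : I < U) (hr : r ∈ I) :
    ∃ m ∈ U, (∀ i ∈ I, ξ i m = 0) ∧ ∃ u ∈ U, ξ m u ≠ 0 := by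
  by_contra! hcon
  obtain ⟨x, hx, hxI⟩ := Set.exists_of_ssubset hI
  exact hxI (hU.mem_of_orthogonal hξ hnd hI.le hr hx fun m hm h => hcon m hm h x hx)

/-- Exchanging along m keeps U ∩ W, since m is orthogonal to it, and gains w. -/
theorem HasRad.exists_radAdj_of_ne (hξ : ξ.IsAlt) {U W : Tang ξ k} {r m w : V}
    (hU : HasRad ξ U.1 r) (hW : HasRad ξ W.1 r) (hm : m ∈ U.1)
    (hmI : ∀ i ∈ U.1 ⊓ W.1, ξ i m = 0) (hw : w ∈ W.1) (hmw : ξ m w ≠ 0) :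
    ∃ X : Tang ξ k, HasRad ξ X.1 r ∧ RadAdj ξ k U X ∧
      finrank F (U.1 ⊓ W.1 : Submodule F V) < finrank F (X.1 ⊓ W.1 : Submodule F V) := by
  obtain ⟨X, hX, hUX, hwX, hmem⟩ := hU.exists_exchange hξ hm (hW.right hw) hmw
  refine ⟨X, hX, hUX, Submodule.finrank_lt_finrank_of_lt (lt_of_le_of_ne
    (le_inf (fun i hi => hmem i hi.1 (hξ.isRefl _ _ (hmI i hi))) inf_le_right) fun e => ?_)⟩
  exact hmw (hξ.isRefl _ _ (hmI w (e ▸ ⟨hwX, hw⟩ : w ∈ U.1 ⊓ W.1)))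

/-- Put I = U ∩ W. One exchange is enough if some m ∈ U ∩ I^⊥ is not orthogonal to W. Otherwise a
first exchange brings in u + w with u ∈ U ∩ I^⊥ and w ∈ W ∩ I^⊥; this vector is orthogonal to I but
not to W, and so permits a second exchange. -/
theorem HasRad.exists_two_steps (hξ : ξ.IsAlt) (hnd : ξ.Nondegenerate) {U W : Tang ξ k} {r : V}
    (hU : HasRad ξ U.1 r) (hW : HasRad ξ W.1 r) (hne : U ≠ W) :
    ∃ X Y : Tang ξ k, RadAdj ξ k U X ∧ RadAdj ξ k X Y ∧ HasRad ξ Y.1 r ∧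
      finrank F (U.1 ⊓ W.1 : Submodule F V) < finrank F (Y.1 ⊓ W.1 : Submodule F V) := by
  have refl : ∀ T : Tang ξ k, RadAdj ξ k T T := fun T => ⟨rfl, by rw [inf_idem, T.2.1]; omega⟩
  by_cases hcase : ∃ m ∈ U.1, (∀ i ∈ U.1 ⊓ W.1, ξ i m = 0) ∧ ∃ w ∈ W.1, ξ m w ≠ 0
  · obtain ⟨m, hm, hmI, w, hw, hmw⟩ := hcase
    obtain ⟨X, hX, hUX, hlt⟩ := hU.exists_radAdj_of_ne hξ hW hm hmI hw hmw
    exact ⟨X, X, hUX, refl X, hX, hlt⟩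
  push Not at hcase
  have hrI : r ∈ U.1 ⊓ W.1 := ⟨hU.mem, hW.mem⟩
  have hIU : U.1 ⊓ W.1 < U.1 := lt_of_le_of_ne inf_le_left fun e =>
    hne (Subtype.ext (Submodule.eq_of_le_of_finrank_eq (inf_eq_left.1 e)
      (U.2.1.trans W.2.1.symm)))
  have hIW : U.1 ⊓ W.1 < W.1 := lt_of_le_of_ne inf_le_right fun e =>
    hne (Subtype.ext (Submodule.eq_of_le_of_finrank_eq (inf_eq_right.1 e)
      (W.2.1.trans U.2.1.symm))).symm
  obtain ⟨m, hm, hmI, u', hu', hmu'⟩ := hU.exists_orthogonal hξ hnd hIU hrI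
  -- Failing this, m would lie in I and, being orthogonal to W, in Rad W = ⟨r⟩, contrary to ξ(m, u')
  -- ≠ 0.
  obtain ⟨u, hu, huI, hmu⟩ : ∃ u ∈ U.1, (∀ i ∈ U.1 ⊓ W.1, ξ i u = 0) ∧ ξ m u ≠ 0 := by
    by_contra! hcon
    have hmem := hU.mem_of_orthogonal hξ hnd hIU.le hrI hm fun v hv hvI =>
      hξ.isRefl _ _ (hcon v hv hvI)
    obtain ⟨t, rfl⟩ := hW.exists_smul hmem.2 fun w hw => hξ.isRefl _ _ (hcase m hm hmI w hw)
    exact hmu' (by simp [hU.left hξ hu'])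
  obtain ⟨w, hw, hwI, w', hw', hww⟩ := hW.exists_orthogonal hξ hnd hIW hrI
  have hmw : ξ m w = 0 := hcase m hm hmI w hw
  obtain ⟨X, hX, hUX, hxX, hmem⟩ := hU.exists_exchange hξ hm (x := u + w)
    (by simp [hU.right hu, hW.right hw]) (by simpa [hmw] using hmu)
  have hle : U.1 ⊓ W.1 ≤ X.1 ⊓ W.1 :=
    le_inf (fun i hi => hmem i hi.1 (hξ.isRefl _ _ (hmI i hi))) inf_le_right
  by_cases e : U.1 ⊓ W.1 = X.1 ⊓ W.1
  · obtain ⟨Y, hY, hXY, hlt⟩ := hX.exists_radAdj_of_ne hξ hW hxX (w := w')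
      (fun i hi => by
        rw [← e] at hi
        simp [huI i hi, hwI i hi]) hw' (by simpa [hcase u hu huI w' hw'] using hww)
    exact ⟨X, Y, hUX, hXY, hY, by rwa [e]⟩
  · exact ⟨X, X, hUX, refl X, hX, Submodule.finrank_lt_finrank_of_lt (lt_of_le_of_ne hle e)⟩

theorem stepRel_of_rad_eq (hξ : ξ.IsAlt) (hnd : ξ.Nondegenerate) (n : ℕ) :
    ∀ U W : Tang ξ k, rad ξ U.1 = rad ξ W.1 →
      k ≤ finrank F (U.1 ⊓ W.1 : Submodule F V) + n → StepRel (RadAdj ξ k) (2 * n) U W := by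
  induction n with
  | zero =>
    intro U W _ hd
    have e1 := Submodule.eq_of_le_of_finrank_le (inf_le_left : U.1 ⊓ W.1 ≤ U.1)
      (by rw [U.2.1]; omega)
    exact Subtype.ext (Submodule.eq_of_le_of_finrank_eq (inf_eq_left.1 e1)
      (U.2.1.trans W.2.1.symm))
  | succ n ih =>
    intro U W hr hd
    have refl : ∀ T : Tang ξ k, RadAdj ξ k T T := fun T => ⟨rfl, by rw [inf_idem, T.2.1]; omega⟩
    by_cases hne : U = W
    · subst hne
      exact ⟨U, refl U, U, refl U, ih U U rfl (by rw [inf_idem, U.2.1]; omega)⟩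
    · obtain ⟨r, hU⟩ := U.2.2.exists_hasRad
      have hW := hU.of_iff hr.symm
      obtain ⟨X, Y, h1, h2, hY, hlt⟩ := hU.exists_two_steps hξ hnd hW hne
      exact ⟨X, h1, Y, h2, ih Y W (hY.2.trans hW.2.symm) (by omega)⟩

/-- Since `RadAdj` is reflexive, short paths can be padded. The fixed length 2k, two steps for each
missing dimension, keeps the condition first-order. -/
theorem rad_eq_iff_stepRel (hξ : ξ.IsAlt) (hnd : ξ.Nondegenerate) (U W : Tang ξ k) :
    rad ξ U.1 = rad ξ W.1 ↔ StepRel (RadAdj ξ k) (2 * k) U W := by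
  refine ⟨fun h => stepRel_of_rad_eq hξ hnd k U W h (by omega), ?_⟩
  generalize 2 * k = n
  induction n generalizing U with
  | zero => rintro rfl; rfl
  | succ n ih =>
    rintro ⟨X, h1, h2⟩
    exact h1.1.trans (ih X h2)

end SameRadical

/-! ### Existence of regular and tangential subspaces -/

section Existence

variable {F V : Type*} [Field F] [AddCommGroup V] [Module F V] [FiniteDimensional F V]
variable {ξ : LinearMap.BilinForm F V} {k : ℕ}

/-- Hyperbolic planes are split off one at a time; when none is left in X orthogonal to H, one has X
≤ H + Rad X, which the dimension bound excludes. -/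
theorem exists_isRegular (hξ : ξ.IsAlt) (X : Submodule F V) (j : ℕ)
    (h : 2 * j + finrank F (rad ξ X) ≤ finrank F X) :
    ∃ H ≤ X, IsRegular ξ H ∧ finrank F H = 2 * j := by
  induction j with
  | zero => exact ⟨⊥, bot_le, by simp [IsRegular, rad], by simp⟩
  | succ j ih =>
    obtain ⟨H, hHX, hH, hd⟩ := ih (by omega)
    obtain ⟨x, y, hx, hy, hxH, hyH, hxy⟩ : ∃ x y, x ∈ X ∧ y ∈ X ∧ (∀ z ∈ H, ξ z x = 0) ∧
        (∀ z ∈ H, ξ z y = 0) ∧ ξ x y ≠ 0 := by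
      by_contra! hcon
      have hle : X ≤ H ⊔ rad ξ X := fun v hv => by
        obtain ⟨a, ha, w, hw, rfl⟩ := hH.exists_add hξ v
        have hwX : w ∈ X := (Submodule.add_mem_iff_right _ (hHX ha)).1 hv
        refine Submodule.add_mem_sup ha ⟨hwX, fun u hu => ?_⟩
        obtain ⟨b, hb, w', hw', rfl⟩ := hH.exists_add hξ u
        have hwX' : w' ∈ X := (Submodule.add_mem_iff_right _ (hHX hb)).1 hu
        simp [hw b hb, hcon w' w hwX' hwX hw' hw]
      have h1 := Submodule.finrank_mono hle
      have h2 := Submodule.finrank_add_le_finrank_add_finrank H (rad ξ X)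
      omega
    have hx0 : x ≠ 0 := by rintro rfl; simp at hxy
    have hyH' : y ∉ H ⊔ Submodule.span F {x} := fun hm => by
      obtain ⟨a, ha, t, rfl⟩ := mem_sup_span.1 hm
      exact hxy (by simp [hξ.isRefl _ _ (hxH a ha), hξ.self_eq_zero])
    refine ⟨H ⊔ Submodule.span F {x} ⊔ Submodule.span F {y}, ?_, ?_, ?_⟩
    · exact sup_le (sup_le hHX ((Submodule.span_singleton_le_iff_mem _ _).2 hx))
        ((Submodule.span_singleton_le_iff_mem _ _).2 hy)
    · rw [isRegular_iff]
      intro v hv hv'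
      obtain ⟨v, hv1, b, rfl⟩ := mem_sup_span.1 hv
      obtain ⟨c, hc, a, rfl⟩ := mem_sup_span.1 hv1
      have hxm : x ∈ H ⊔ Submodule.span F {x} := mem_sup_span.2 ⟨0, zero_mem _, 1, by simp⟩
      have hb : b = 0 := by
        have := hv' x (Submodule.mem_sup_left hxm)
        simpa [hξ.isRefl _ _ (hxH c hc), hξ.self_eq_zero, hxy] using this
      have hyx : ξ y x ≠ 0 := fun e => hxy (hξ.isRefl _ _ e)
      have ha : a = 0 := by
        have := hv' y (mem_sup_span.2 ⟨0, zero_mem _, 1, by simp⟩)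
        simpa [hξ.isRefl _ _ (hyH c hc), hξ.self_eq_zero, hyx] using this
      subst ha hb
      simpa using isRegular_iff.1 hH c hc fun z hz => by
        simpa using hv' z (Submodule.mem_sup_left (Submodule.mem_sup_left hz))
    · rw [Submodule.finrank_sup_span_singleton hyH', hH.finrank_sup hx0 hxH, hd]
      ring

/-- In odd dimension V would contain a regular hyperplane and hence be tangential. -/
theorem even_finrank (hξ : ξ.IsAlt) (hnd : ξ.Nondegenerate) : Even (finrank F V) := by
  by_contra hodd
  obtain ⟨j, hj⟩ := Nat.not_even_iff_odd.1 hodd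
  have hr : rad ξ (⊤ : Submodule F V) = ⊥ := by
    rw [rad, LinearMap.BilinForm.orthogonal_top_eq_bot hnd, inf_bot_eq]
  obtain ⟨H, hH, hreg, hd⟩ := exists_isRegular hξ (⊤ : Submodule F V) j (by
    rw [hr, finrank_bot, finrank_top]; omega)
  have := hreg.isTangential hξ hH (by rw [hd, finrank_top, hj])
  rw [IsTangential, hr, finrank_bot] at this
  omega

theorem exists_hasRad (hξ : ξ.IsAlt) (hnd : ξ.Nondegenerate) (hk : Odd k)
    (hkn : k + 1 ≤ finrank F V) {p : V} (hp : p ≠ 0) : ∃ U : Tang ξ k, HasRad ξ U.1 p := by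
  obtain ⟨j, rfl⟩ := hk
  have h1 := LinearMap.BilinForm.finrank_orthogonal hnd (Submodule.span F {p})
  rw [finrank_span_singleton hp] at h1
  have h2 : finrank F (rad ξ (ξ.orthogonal (Submodule.span F {p}))) ≤ 1 := by
    rw [← finrank_span_singleton (K := F) hp]
    refine Submodule.finrank_mono ?_
    rw [rad, LinearMap.BilinForm.orthogonal_orthogonal hnd hξ.isRefl]
    exact inf_le_right
  obtain ⟨H, hH, hreg, hd⟩ := exists_isRegular hξ _ j
    (show 2 * j + _ ≤ finrank F (ξ.orthogonal (Submodule.span F {p})) by omega)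
  have hpH : ∀ y ∈ H, ξ y p = 0 := fun y hy =>
    hξ.isRefl _ _ (hH hy p (Submodule.mem_span_singleton_self p))
  have hr := hreg.hasRad_sup hξ hp hpH
  exact ⟨⟨_, by rw [hreg.finrank_sup hp hpH, hd], hr.isTangential⟩, hr⟩

/-- The complement of the line pq has dimension n - 2 and radical of dimension at most 2, so k + 3 ≤
n leaves room there for a regular H of dimension k - 1. Take H + ⟨p⟩ and H + ⟨q⟩. -/
theorem exists_orthAdj (hξ : ξ.IsAlt) (hnd : ξ.Nondegenerate) (hk : Odd k)
    (hkn : k + 3 ≤ finrank F V) {p q : V} (hp : p ≠ 0) (hq : q ∉ Submodule.span F {p})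
    (hpq : ξ p q = 0) :
    ∃ U W : Tang ξ k, HasRad ξ U.1 p ∧ HasRad ξ W.1 q ∧ OrthAdj ξ k U W := by
  obtain ⟨j, rfl⟩ := hk
  have hq0 : q ≠ 0 := by rintro rfl; exact hq (zero_mem _)
  set L := Submodule.span F {p} ⊔ Submodule.span F {q} with hL
  have hLd : finrank F L = 2 := by
    rw [hL, Submodule.finrank_sup_span_singleton hq, finrank_span_singleton hp]
  have h1 := LinearMap.BilinForm.finrank_orthogonal hnd L
  have h2 : finrank F (rad ξ (ξ.orthogonal L)) ≤ 2 := by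
    rw [← hLd]
    refine Submodule.finrank_mono ?_
    rw [rad, LinearMap.BilinForm.orthogonal_orthogonal hnd hξ.isRefl]
    exact inf_le_right
  obtain ⟨H, hH, hreg, hd⟩ := exists_isRegular hξ _ j
    (show 2 * j + _ ≤ finrank F (ξ.orthogonal L) by omega)
  have hpH : ∀ y ∈ H, ξ y p = 0 := fun y hy =>
    hξ.isRefl _ _ (hH hy p (Submodule.mem_sup_left (Submodule.mem_span_singleton_self p)))
  have hqH : ∀ y ∈ H, ξ y q = 0 := fun y hy =>
    hξ.isRefl _ _ (hH hy q (Submodule.mem_sup_right (Submodule.mem_span_singleton_self q)))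
  obtain ⟨U, eU⟩ : ∃ U : Tang ξ (2 * j + 1), U.1 = H ⊔ Submodule.span F {p} :=
    ⟨⟨_, by rw [hreg.finrank_sup hp hpH, hd], (hreg.hasRad_sup hξ hp hpH).isTangential⟩, rfl⟩
  obtain ⟨W, eW⟩ : ∃ W : Tang ξ (2 * j + 1), W.1 = H ⊔ Submodule.span F {q} :=
    ⟨⟨_, by rw [hreg.finrank_sup hq0 hqH, hd], (hreg.hasRad_sup hξ hq0 hqH).isTangential⟩, rfl⟩
  have hU : HasRad ξ U.1 p := eU ▸ hreg.hasRad_sup hξ hp hpH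
  have hW : HasRad ξ W.1 q := eW ▸ hreg.hasRad_sup hξ hq0 hqH
  refine ⟨U, W, hU, hW, botAdj_of_regular hreg (by rw [hd]) (eU ▸ le_sup_left)
    (eW ▸ le_sup_left) fun e => hq ?_, (hU.perp_iff hW).2 hpq⟩
  rw [← hU.2, e, hW.2]
  exact Submodule.mem_span_singleton_self q

end Existence

/-! ### The relations defined by adjacency -/

section Definable

variable {F V : Type*} [Field F] [AddCommGroup V] [Module F V] [FiniteDimensional F V]
variable {ξ : LinearMap.BilinForm F V} {k : ℕ}

theorem FORel.stepRel {M : Type*} {r R : M → M → Prop} (h : FORel r R) (n : ℕ) :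
    FORel r (StepRel R n) := by
  induction n with
  | zero => exact FORel.eq
  | succ n ih =>
    refine FORel.intro (FOPred.ex (FOPred.and ?_ ?_))
    · exact h.app (Sum.inl 0) (Sum.inr 0)
    · exact ih.app (Sum.inr 0) (Sum.inl 1)

/-- The clique criterion describes `SumTriangle` only for adjacent base vertices, hence the extra
conjunct; it is discarded later, where adjacency is known. -/
theorem foPred_sumTriangle (hξ : ξ.IsAlt) (h2 : (2 : F) ≠ 0) (hk : 3 ≤ k) {ι : Type}
    (i j l : ι) : FOPred (BotAdj ξ k) fun v : ι → Tang ξ k =>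
      BotAdj ξ k (v i) (v j) ∧ SumTriangle ξ k (v i) (v j) (v l) := by
  have hr : FORel (BotAdj ξ k) (BotAdj ξ k) := FORel.self
  have heq : FORel (BotAdj ξ k) (fun U W : Tang ξ k => U = W) := FORel.eq
  have key : FOPred (BotAdj ξ k) fun v : ι → Tang ξ k =>
      BotAdj ξ k (v i) (v j) ∧ BotAdj ξ k (v l) (v i) ∧ BotAdj ξ k (v l) (v j) ∧
      ∃ Y Y' : Tang ξ k, (BotAdj ξ k Y (v i) ∧ BotAdj ξ k Y (v j) ∧ BotAdj ξ k Y (v l)) ∧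
      (BotAdj ξ k Y' (v i) ∧ BotAdj ξ k Y' (v j) ∧ BotAdj ξ k Y' (v l)) ∧ ¬ Y = Y' ∧
      ¬ BotAdj ξ k Y Y' := by
    refine FOPred.and ?_ (FOPred.and ?_ (FOPred.and ?_ (FOPred.ex (FOPred.ex
      (FOPred.and (FOPred.and ?_ (FOPred.and ?_ ?_)) (FOPred.and (FOPred.and ?_
        (FOPred.and ?_ ?_)) (FOPred.and (FOPred.not ?_) (FOPred.not ?_))))))))
    · exact hr.app i j
    · exact hr.app l i
    · exact hr.app l j
    · exact hr.app (Sum.inl (Sum.inr 0)) (Sum.inl (Sum.inl i))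
    · exact hr.app (Sum.inl (Sum.inr 0)) (Sum.inl (Sum.inl j))
    · exact hr.app (Sum.inl (Sum.inr 0)) (Sum.inl (Sum.inl l))
    · exact hr.app (Sum.inr 0) (Sum.inl (Sum.inl i))
    · exact hr.app (Sum.inr 0) (Sum.inl (Sum.inl j))
    · exact hr.app (Sum.inr 0) (Sum.inl (Sum.inl l))
    · exact heq.app (Sum.inl (Sum.inr 0)) (Sum.inr 0)
    · exact hr.app (Sum.inl (Sum.inr 0)) (Sum.inr 0)
  refine key.congr fun v => and_congr_right fun h => ⟨fun hZ => ?_, ?_⟩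
  · exact ⟨hZ.1, hZ.2.1, hZ.exists_not_botAdj hξ h2 hk h⟩
  · rintro ⟨h1, h3, Y, Y', ⟨a1, a2, a3⟩, ⟨b1, b2, b3⟩, hne, hna⟩
    refine ⟨h1, h3, ?_⟩
    by_contra hZ
    exact (eq_or_botAdj_of_not_le_sup h h1 h3 hZ a1 a2 a3 b1 b2 b3).elim hne hna

theorem foRel_orthAdj (hξ : ξ.IsAlt) (h2 : (2 : F) ≠ 0) (hk : 3 ≤ k) :
    FORel (BotAdj ξ k) (OrthAdj ξ k) := by
  have hr : FORel (BotAdj ξ k) (BotAdj ξ k) := FORel.self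
  have key : FORel (BotAdj ξ k) fun U W => BotAdj ξ k U W ∧ ∀ X Y Z,
      (BotAdj ξ k U W ∧ SumTriangle ξ k U W X) → (BotAdj ξ k U W ∧ SumTriangle ξ k U W Y) →
      (BotAdj ξ k U W ∧ SumTriangle ξ k U W Z) → ¬ BotAdj ξ k X Y → ¬ BotAdj ξ k Y Z →
      ¬ BotAdj ξ k X Z := by
    refine FORel.intro (FOPred.and ?_ (FOPred.all (FOPred.all (FOPred.all
      (FOPred.imp ?_ (FOPred.imp ?_ (FOPred.imp ?_ (FOPred.imp (FOPred.not ?_)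
        (FOPred.imp (FOPred.not ?_) (FOPred.not ?_))))))))))
    · exact hr.app 0 1
    · exact foPred_sumTriangle hξ h2 hk (Sum.inl (Sum.inl (Sum.inl 0))) (Sum.inl (Sum.inl (Sum.inl 1)))
        (Sum.inl (Sum.inl (Sum.inr 0)))
    · exact foPred_sumTriangle hξ h2 hk (Sum.inl (Sum.inl (Sum.inl 0))) (Sum.inl (Sum.inl (Sum.inl 1)))
        (Sum.inl (Sum.inr 0))
    · exact foPred_sumTriangle hξ h2 hk (Sum.inl (Sum.inl (Sum.inl 0))) (Sum.inl (Sum.inl (Sum.inl 1))) (Sum.inr 0)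
    · exact hr.app (Sum.inl (Sum.inl (Sum.inr 0))) (Sum.inl (Sum.inr 0))
    · exact hr.app (Sum.inl (Sum.inr 0)) (Sum.inr 0)
    · exact hr.app (Sum.inl (Sum.inl (Sum.inr 0))) (Sum.inr 0)
  refine key.congr fun U W => (orthAdj_iff hξ hk).trans (and_congr_right fun h => ?_)
  simp only [h, true_and]

theorem foRel_radAdj (hξ : ξ.IsAlt) (h2 : (2 : F) ≠ 0) (hk : 3 ≤ k) :
    FORel (BotAdj ξ k) (RadAdj ξ k) := by
  have hr : FORel (BotAdj ξ k) (BotAdj ξ k) := FORel.self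
  have ho := foRel_orthAdj hξ h2 hk
  have key : FORel (BotAdj ξ k) fun Y Y' => Y = Y' ∨ ∃ U W, OrthAdj ξ k U W ∧
      (BotAdj ξ k U W ∧ SumTriangle ξ k U W Y) ∧ (BotAdj ξ k U W ∧ SumTriangle ξ k U W Y') ∧
      ¬ BotAdj ξ k Y Y' := by
    refine FORel.intro (FOPred.or ?_ (FOPred.ex (FOPred.ex
      (FOPred.and ?_ (FOPred.and ?_ (FOPred.and ?_ (FOPred.not ?_)))))))
    · exact FORel.eq
    · exact ho.app (Sum.inl (Sum.inr 0)) (Sum.inr 0)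
    · exact foPred_sumTriangle hξ h2 hk (Sum.inl (Sum.inr 0)) (Sum.inr 0) (Sum.inl (Sum.inl 0))
    · exact foPred_sumTriangle hξ h2 hk (Sum.inl (Sum.inr 0)) (Sum.inr 0) (Sum.inl (Sum.inl 1))
    · exact hr.app (Sum.inl (Sum.inl 0)) (Sum.inl (Sum.inl 1))
  refine key.congr fun Y Y' => (radAdj_iff hξ).trans (or_congr_right
    (exists_congr fun U => exists_congr fun W => and_congr_right fun h => ?_))
  simp only [h.1, true_and]

theorem foRel_rad_eq (hξ : ξ.IsAlt) (hnd : ξ.Nondegenerate) (h2 : (2 : F) ≠ 0) (hk : 3 ≤ k) :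
    FORel (BotAdj ξ k) fun U W => rad ξ U.1 = rad ξ W.1 :=
  ((foRel_radAdj hξ h2 hk).stepRel (2 * k)).congr fun U W => rad_eq_iff_stepRel hξ hnd U W

/-- Let x span Rad X. If x ⊥ W lies in W, it spans Rad W. If not, Z = H + ⟨x⟩ works for any
complement H of Rad W in W. Conversely, W = (W ∩ Z) + Rad W, and Rad Z is orthogonal to both
summands. -/
theorem perp_rad_left_iff (hξ : ξ.IsAlt) (X W : Tang ξ k) : Perp ξ (rad ξ X.1) W.1 ↔
    rad ξ X.1 = rad ξ W.1 ∨ ∃ Z, OrthAdj ξ k W Z ∧ rad ξ X.1 = rad ξ Z.1 := by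
  obtain ⟨x, hX⟩ := X.2.2.exists_hasRad
  obtain ⟨q, hW⟩ := W.2.2.exists_hasRad
  constructor
  · intro h
    have hx : ∀ w ∈ W.1, ξ w x = 0 := fun w hw => hξ.isRefl _ _ (h x hX.mem_rad w hw)
    by_cases hxW : x ∈ W.1
    · exact .inl (hX.2.trans (HasRad.of_mem W.2.2 hX.1 hxW hx).2.symm)
    · right
      obtain ⟨H, hHW, hqH, hd⟩ := hW.exists_compl
      have hreg := hW.isRegular_of_notMem hξ hHW hqH hd
      rw [W.2.1] at hd
      have hxH : ∀ w ∈ H, ξ w x = 0 := fun w hw => hx w (hHW hw)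
      have hZ := hreg.hasRad_sup hξ hX.1 hxH
      obtain ⟨Z, eZ⟩ : ∃ Z : Tang ξ k, Z.1 = H ⊔ Submodule.span F {x} :=
        ⟨⟨_, by rw [hreg.finrank_sup hX.1 hxH, hd], hZ.isTangential⟩, rfl⟩
      rw [← eZ] at hZ
      refine ⟨Z, ⟨botAdj_of_regular hreg hd hHW (eZ ▸ le_sup_left) fun e =>
        hxW (e ▸ hZ.mem), (hW.perp_iff hZ).2 (hx q hW.mem)⟩, hX.2.trans hZ.2.symm⟩
  · rintro (h | ⟨Z, hWZ, h⟩)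
    · rw [h]
      exact fun u hu w hw => hξ.isRefl _ _ (hu.2 w hw)
    · have hZ : HasRad ξ Z.1 x := hX.of_iff h.symm
      rw [perp_rad_iff hX]
      intro w hw
      rw [← hWZ.1.sup_eq hW, mem_sup_span] at hw
      obtain ⟨y, hy, t, rfl⟩ := hw
      simp [hZ.left hξ hy.2, hξ.isRefl _ _ ((hW.perp_iff hZ).1 hWZ.2)]

theorem foRel_perp_rad_left (hξ : ξ.IsAlt) (hnd : ξ.Nondegenerate) (h2 : (2 : F) ≠ 0)
    (hk : 3 ≤ k) : FORel (BotAdj ξ k) fun U W => Perp ξ (rad ξ U.1) W.1 := by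
  have hr := foRel_rad_eq hξ hnd h2 hk
  have ho := foRel_orthAdj hξ h2 hk
  have key : FORel (BotAdj ξ k) fun X W => rad ξ X.1 = rad ξ W.1 ∨
      ∃ Z, OrthAdj ξ k W Z ∧ rad ξ X.1 = rad ξ Z.1 := by
    refine FORel.intro (FOPred.or hr (FOPred.ex (FOPred.and ?_ ?_)))
    · exact ho.app (Sum.inl 1) (Sum.inr 0)
    · exact hr.app (Sum.inl 0) (Sum.inr 0)
  exact key.congr fun X W => perp_rad_left_iff hξ X W

theorem perp_rad_rad_iff (hξ : ξ.IsAlt) (hnd : ξ.Nondegenerate) (hk : Odd k)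
    (hkn : k + 3 ≤ finrank F V) (U W : Tang ξ k) : Perp ξ (rad ξ U.1) (rad ξ W.1) ↔
      rad ξ U.1 = rad ξ W.1 ∨ ∃ U' W', rad ξ U.1 = rad ξ U'.1 ∧ rad ξ W.1 = rad ξ W'.1 ∧
        OrthAdj ξ k U' W' := by
  obtain ⟨p, hU⟩ := U.2.2.exists_hasRad
  obtain ⟨q, hW⟩ := W.2.2.exists_hasRad
  constructor
  · intro h
    by_cases hq : q ∈ Submodule.span F {p}
    · left
      rw [hU.2, hW.2]
      refine (Submodule.eq_of_le_of_finrank_eq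
        ((Submodule.span_singleton_le_iff_mem _ _).2 hq) ?_).symm
      rw [finrank_span_singleton hU.1, finrank_span_singleton hW.1]
    · right
      obtain ⟨U', W', hU', hW', ho⟩ :=
        exists_orthAdj hξ hnd hk hkn hU.1 hq ((hU.perp_iff hW).1 h)
      exact ⟨U', W', hU.2.trans hU'.2.symm, hW.2.trans hW'.2.symm, ho⟩
  · rintro (h | ⟨U', W', h1, h2, ho⟩)
    · exact fun u hu w hw => hw.2 u ((h ▸ hu : u ∈ rad ξ W.1)).1
    · rw [h1, h2]
      exact ho.2

/-- For k = n - 1 the subspace W is the complement of its own radical, so Rad U ⊥ Rad W means Rad U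
≤ W, which is non-adjacency inside V. -/
theorem perp_rad_rad_iff_not_botAdj (hξ : ξ.IsAlt) (hnd : ξ.Nondegenerate)
    (hkn : k + 1 = finrank F V) (U W : Tang ξ k) :
    Perp ξ (rad ξ U.1) (rad ξ W.1) ↔ ¬ BotAdj ξ k U W := by
  obtain ⟨p, hU⟩ := U.2.2.exists_hasRad
  obtain ⟨q, hW⟩ := W.2.2.exists_hasRad
  rw [botAdj_iff_notMem hξ hU (B := ⊤) (by rw [finrank_top, hkn]) le_top le_top, not_not,
    hU.perp_iff hW]
  have e : W.1 = ξ.orthogonal (Submodule.span F {q}) := by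
    refine Submodule.eq_of_le_of_finrank_eq (fun w hw y hy => ?_) ?_
    · obtain ⟨t, rfl⟩ := Submodule.mem_span_singleton.1 hy
      simp [hW.left hξ hw]
    · rw [LinearMap.BilinForm.finrank_orthogonal hnd, finrank_span_singleton hW.1, W.2.1]
      omega
  refine ⟨fun h => ?_, fun h => hW.right h⟩
  rw [e]
  intro y hy
  obtain ⟨t, rfl⟩ := Submodule.mem_span_singleton.1 hy
  simp [hξ.isRefl _ _ h]

theorem foRel_perp_rad_rad (hξ : ξ.IsAlt) (hnd : ξ.Nondegenerate) (h2 : (2 : F) ≠ 0)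
    (hk : 3 ≤ k) (hodd : Odd k) (hkn : k + 1 ≤ finrank F V) :
    FORel (BotAdj ξ k) fun U W => Perp ξ (rad ξ U.1) (rad ξ W.1) := by
  by_cases hkn' : k + 1 = finrank F V
  · exact FORel.congr (R := fun U W => ¬ BotAdj ξ k U W) (FOPred.not FORel.self)
      fun U W => perp_rad_rad_iff_not_botAdj hξ hnd hkn' U W
  -- Since k is odd and n even, k + 1 < n skips k + 2 = n.
  have hkn3 : k + 3 ≤ finrank F V := by
    obtain ⟨a, ha⟩ := hodd
    obtain ⟨b, hb⟩ := even_finrank hξ hnd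
    omega
  have hr := foRel_rad_eq hξ hnd h2 hk
  have ho := foRel_orthAdj hξ h2 hk
  have key : FORel (BotAdj ξ k) fun U W => rad ξ U.1 = rad ξ W.1 ∨ ∃ U' W',
      rad ξ U.1 = rad ξ U'.1 ∧ rad ξ W.1 = rad ξ W'.1 ∧ OrthAdj ξ k U' W' := by
    refine FORel.intro (FOPred.or hr (FOPred.ex (FOPred.ex (FOPred.and ?_ (FOPred.and ?_ ?_)))))
    · exact hr.app (Sum.inl (Sum.inl 0)) (Sum.inl (Sum.inr 0))
    · exact hr.app (Sum.inl (Sum.inl 1)) (Sum.inr 0)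
    · exact ho.app (Sum.inl (Sum.inr 0)) (Sum.inr 0)
  exact key.congr fun U W => perp_rad_rad_iff hξ hnd hodd hkn3 U W

end Definable

/-! ### Coding of points and lines -/

section Codes

variable {F V : Type*} [Field F] [AddCommGroup V] [Module F V]
variable {ξ : LinearMap.BilinForm F V} {k : ℕ}

theorem perp_comm (hξ : ξ.IsAlt) {S T : Submodule F V} : Perp ξ S T ↔ Perp ξ T S :=
  ⟨fun h u hu w hw => hξ.isRefl _ _ (h w hw u hu), fun h u hu w hw => hξ.isRefl _ _ (h w hw u hu)⟩

theorem perp_sup_right {S T T' : Submodule F V} :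
    Perp ξ S (T ⊔ T') ↔ Perp ξ S T ∧ Perp ξ S T' := by
  refine ⟨fun h => ⟨fun u hu w hw => h u hu w (Submodule.mem_sup_left hw),
    fun u hu w hw => h u hu w (Submodule.mem_sup_right hw)⟩, fun h u hu w hw => ?_⟩
  obtain ⟨x, hx, y, hy, rfl⟩ := Submodule.mem_sup.1 hw
  simp [h.1 u hu x hx, h.2 u hu y hy]

theorem orthogonal_sup (S T : Submodule F V) :
    ξ.orthogonal (S ⊔ T) = ξ.orthogonal S ⊓ ξ.orthogonal T := by
  refine le_antisymm (le_inf (LinearMap.BilinForm.orthogonal_le le_sup_left)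
    (LinearMap.BilinForm.orthogonal_le le_sup_right)) fun x hx y hy => ?_
  obtain ⟨s, hs, t, ht, rfl⟩ := Submodule.mem_sup.1 hy
  simp [hx.1 s hs, hx.2 t ht]

/-- A point is coded by the tangential subspaces whose radical it is. -/
def pointCoding (H : ∀ p : V, p ≠ 0 → ∃ U : Tang ξ k, HasRad ξ U.1 p) :
    Coding (Tang ξ k) (Point F V) where
  arity := 1
  dom := Set.univ
  decode x := ⟨rad ξ (x.1 0).1, (x.1 0).2.2⟩
  surj l := by
    obtain ⟨⟨v, hv⟩, hv0, -⟩ := finrank_eq_one_iff'.1 l.2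
    have hv0' : v ≠ 0 := fun h => hv0 (by simpa using h)
    obtain ⟨U, hU⟩ := H v hv0'
    refine ⟨⟨fun _ => U, trivial⟩, Subtype.ext ?_⟩
    have : FiniteDimensional F l.1 := FiniteDimensional.of_finrank_eq_succ l.2
    refine hU.2.trans (Submodule.eq_of_le_of_finrank_eq
      ((Submodule.span_singleton_le_iff_mem _ _).2 hv) ?_)
    rw [finrank_span_singleton hv0', l.2]

variable [FiniteDimensional F V]

theorem finrank_rad_sup_rad {U W : Tang ξ k} (h : ¬ rad ξ U.1 = rad ξ W.1) :
    finrank F (rad ξ U.1 ⊔ rad ξ W.1 : Submodule F V) = 2 := by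
  obtain ⟨p, hU⟩ := U.2.2.exists_hasRad
  obtain ⟨q, hW⟩ := W.2.2.exists_hasRad
  rw [hU.2, hW.2] at h ⊢
  rw [Submodule.finrank_sup_span_singleton, finrank_span_singleton hU.1]
  intro hq
  refine h (Submodule.eq_of_le_of_finrank_eq
    ((Submodule.span_singleton_le_iff_mem _ _).2 hq) ?_).symm
  rw [finrank_span_singleton hU.1, finrank_span_singleton hW.1]

/-- A line is coded by the pairs of codes of distinct points on it. -/
def lineCoding (H : ∀ p : V, p ≠ 0 → ∃ U : Tang ξ k, HasRad ξ U.1 p) :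
    Coding (Tang ξ k) (Line F V) where
  arity := 2
  dom := {x | ¬ rad ξ (x 0).1 = rad ξ (x 1).1}
  decode x := ⟨rad ξ (x.1 0).1 ⊔ rad ξ (x.1 1).1, finrank_rad_sup_rad x.2⟩
  surj l := by
    have hl0 : l.1 ≠ ⊥ := fun e => by
      have := l.2
      rw [e, finrank_bot] at this
      omega
    obtain ⟨p, hp, hp0⟩ := Submodule.exists_mem_ne_zero_of_ne_bot hl0
    have hlt : Submodule.span F {p} < l.1 := lt_of_le_of_ne
      ((Submodule.span_singleton_le_iff_mem _ _).2 hp) fun e => by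
        have := l.2
        rw [← e, finrank_span_singleton hp0] at this
        omega
    obtain ⟨q, hq, hqp⟩ := Set.exists_of_ssubset hlt
    obtain ⟨U, hU⟩ := H p hp0
    obtain ⟨W, hW⟩ := H q (by rintro rfl; exact hqp (zero_mem _))
    refine ⟨⟨![U, W], fun e => hqp ?_⟩, Subtype.ext ?_⟩
    · change rad ξ U.1 = rad ξ W.1 at e
      rw [hU.2] at e
      rw [SetLike.mem_coe, e]
      exact hW.mem_rad
    · change rad ξ U.1 ⊔ rad ξ W.1 = l.1
      rw [hU.2, hW.2]
      exact sup_span_eq_of_finrank hlt.le hq hqp (by rw [finrank_span_singleton hp0, l.2])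

theorem le_iff_perp (hξ : ξ.IsAlt) (hnd : ξ.Nondegenerate)
    (H : ∀ p : V, p ≠ 0 → ∃ U : Tang ξ k, HasRad ξ U.1 p) {S T : Submodule F V} :
    S ≤ T ↔ ∀ X : Tang ξ k, Perp ξ (rad ξ X.1) T → Perp ξ (rad ξ X.1) S := by
  refine ⟨fun h X hX u hu w hw => hX u hu w (h hw), fun h s hs => ?_⟩
  rw [← LinearMap.BilinForm.orthogonal_orthogonal hnd hξ.isRefl T]
  intro x hx
  by_cases hx0 : x = 0
  · simp [hx0]
  obtain ⟨X, hX⟩ := H x hx0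
  refine h X ?_ x hX.mem_rad s hs
  rw [perp_rad_iff hX]
  exact fun t ht => hξ.isRefl _ _ (hx t ht)

/-- The geometry is definable once the orthogonality of radicals and the relation
"the radical of `U` is contained in `W`" are. -/
theorem definesGeometry_of_foRel (hξ : ξ.IsAlt) (hnd : ξ.Nondegenerate)
    (H : ∀ p : V, p ≠ 0 → ∃ U : Tang ξ k, HasRad ξ U.1 p) {r : Tang ξ k → Tang ξ k → Prop}
    (hperp : FORel r fun U W => Perp ξ (rad ξ U.1) (rad ξ W.1))
    (hle : FORel r fun U W => rad ξ U.1 ≤ W.1) : DefinesGeometry ξ k r := by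
  -- Equality is recovered from orthogonality alone: containment between points is already equality.
  have heq : FORel r fun U W => rad ξ U.1 = rad ξ W.1 := by
    have key : FORel r fun U W => ∀ X : Tang ξ k, Perp ξ (rad ξ X.1) (rad ξ W.1) →
        Perp ξ (rad ξ X.1) (rad ξ U.1) := by
      refine FORel.intro (FOPred.all (FOPred.imp ?_ ?_))
      · exact hperp.app (Sum.inr 0) (Sum.inl 1)
      · exact hperp.app (Sum.inr 0) (Sum.inl 0)
    refine key.congr fun U W => Iff.trans ⟨fun h => h.le, fun h => ?_⟩ (le_iff_perp hξ hnd H)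
    exact Submodule.eq_of_le_of_finrank_eq h (Eq.trans U.2.2 (Eq.symm W.2.2))
  have hinc : ∀ {ι : Type} (i j l : ι), FOPred r fun v : ι → Tang ξ k =>
      rad ξ (v i).1 ≤ rad ξ (v j).1 ⊔ rad ξ (v l).1 := by
    intro ι i j l
    have key : FOPred r fun v : ι → Tang ξ k => ∀ X : Tang ξ k,
        (Perp ξ (rad ξ X.1) (rad ξ (v j).1) ∧ Perp ξ (rad ξ X.1) (rad ξ (v l).1)) →
        Perp ξ (rad ξ X.1) (rad ξ (v i).1) := by
      refine FOPred.all (FOPred.imp (FOPred.and ?_ ?_) ?_)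
      · exact hperp.app (Sum.inr 0) (Sum.inl j)
      · exact hperp.app (Sum.inr 0) (Sum.inl l)
      · exact hperp.app (Sum.inr 0) (Sum.inl i)
    refine key.congr fun v => (le_iff_perp hξ hnd H).trans (forall_congr' fun X => ?_)
    rw [perp_sup_right]
  have hdom : ∀ {ι : Type} (j l : ι), FOPred r fun v : ι → Tang ξ k =>
      ¬ rad ξ (v j).1 = rad ξ (v l).1 := fun j l => (heq.app j l).not
  refine ⟨pointCoding H, lineCoding H, ?_, ?_, ?_, ?_, ?_, ?_, ?_, ?_, ?_⟩
  · let := relStructure r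
    exact Set.definable_univ
  · exact hdom (0 : Fin 2) 1
  · refine FOPred.congr (heq.app (ι := Fin 1 ⊕ Fin 1) (Sum.inl 0) (Sum.inr 0)) fun v => ?_
    exact ⟨fun ⟨_, _, h⟩ => congrArg Subtype.val h, fun h => ⟨trivial, trivial, Subtype.ext h⟩⟩
  · refine FOPred.congr (((hdom (ι := Fin 2 ⊕ Fin 2) (Sum.inl 0) (Sum.inl 1)).and
      (hdom (Sum.inr 0) (Sum.inr 1))).and
      ((hinc (Sum.inl 0) (Sum.inr 0) (Sum.inr 1)).and (hinc (Sum.inl 1) (Sum.inr 0) (Sum.inr 1))))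
      fun (v : Fin 2 ⊕ Fin 2 → Tang ξ k) => ?_
    constructor
    · rintro ⟨h1, h2, h⟩
      have h3 : rad ξ (v (Sum.inl 0)).1 ⊔ rad ξ (v (Sum.inl 1)).1 =
        rad ξ (v (Sum.inr 0)).1 ⊔ rad ξ (v (Sum.inr 1)).1 := congrArg Subtype.val h
      exact ⟨⟨h1, h2⟩, h3 ▸ le_sup_left, h3 ▸ le_sup_right⟩
    · rintro ⟨⟨h1, h2⟩, h3, h4⟩
      exact ⟨h1, h2, Subtype.ext (Submodule.eq_of_le_of_finrank_eq (sup_le h3 h4)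
        ((finrank_rad_sup_rad h1).trans (finrank_rad_sup_rad h2).symm))⟩
  · refine FOPred.congr ((hdom (ι := Fin 1 ⊕ Fin 2) (Sum.inr 0) (Sum.inr 1)).and
      (hinc (Sum.inl 0) (Sum.inr 0) (Sum.inr 1))) fun v => ?_
    exact ⟨fun ⟨_, h, h'⟩ => ⟨h, h'⟩, fun ⟨h, h'⟩ => ⟨trivial, h, h'⟩⟩
  · refine FOPred.congr (hperp.app (ι := Fin 1 ⊕ Fin 1) (Sum.inl 0) (Sum.inr 0)) fun v => ?_
    exact ⟨fun ⟨_, _, h⟩ => h, fun h => ⟨trivial, trivial, h⟩⟩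
  · refine FOPred.congr ((hdom (ι := Fin 1 ⊕ Fin 2) (Sum.inr 0) (Sum.inr 1)).and
      ((hperp.app (Sum.inl 0) (Sum.inr 0)).and (hperp.app (Sum.inl 0) (Sum.inr 1)))) fun v => ?_
    exact ⟨fun ⟨_, h, h'⟩ => ⟨h, perp_sup_right.1 h'⟩,
      fun ⟨h, h'⟩ => ⟨trivial, h, perp_sup_right.2 h'⟩⟩
  · refine FOPred.congr (((hdom (ι := Fin 2 ⊕ Fin 2) (Sum.inl 0) (Sum.inl 1)).and
      (hdom (Sum.inr 0) (Sum.inr 1))).and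
      (((hperp.app (Sum.inr 0) (Sum.inl 0)).and (hperp.app (Sum.inr 0) (Sum.inl 1))).and
        ((hperp.app (Sum.inr 1) (Sum.inl 0)).and (hperp.app (Sum.inr 1) (Sum.inl 1)))))
      fun (v : Fin 2 ⊕ Fin 2 → Tang ξ k) => ?_
    have e : Perp ξ (rad ξ (v (Sum.inl 0)).1 ⊔ rad ξ (v (Sum.inl 1)).1)
        (rad ξ (v (Sum.inr 0)).1 ⊔ rad ξ (v (Sum.inr 1)).1) ↔
        (Perp ξ (rad ξ (v (Sum.inr 0)).1) (rad ξ (v (Sum.inl 0)).1) ∧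
          Perp ξ (rad ξ (v (Sum.inr 0)).1) (rad ξ (v (Sum.inl 1)).1)) ∧
        (Perp ξ (rad ξ (v (Sum.inr 1)).1) (rad ξ (v (Sum.inl 0)).1) ∧
          Perp ξ (rad ξ (v (Sum.inr 1)).1) (rad ξ (v (Sum.inl 1)).1)) := by
      rw [perp_sup_right, perp_comm hξ, perp_sup_right, perp_comm hξ (T := rad ξ (v (Sum.inr 1)).1),
        perp_sup_right]
    exact ⟨fun ⟨h, h', h''⟩ => ⟨⟨h, h'⟩, e.1 h''⟩, fun ⟨⟨h, h'⟩, h''⟩ => ⟨h, h', e.2 h''⟩⟩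
  · refine FOPred.congr (hle.app (ι := Fin 1 ⊕ Fin 1) (Sum.inl 0) (Sum.inr 0)) fun v => ?_
    exact ⟨fun ⟨_, _, h⟩ => h, fun h => ⟨trivial, trivial, h⟩⟩

theorem definesGeometry_botAdj (hξ : ξ.IsAlt) (hnd : ξ.Nondegenerate) (h2 : (2 : F) ≠ 0)
    (hk : 3 ≤ k) (hodd : Odd k) (hkn : k + 1 ≤ finrank F V) :
    DefinesGeometry ξ k (BotAdj ξ k) := by
  have H := fun p (hp : p ≠ 0) => exists_hasRad hξ hnd hodd hkn hp
  have hperp := foRel_perp_rad_rad hξ hnd h2 hk hodd hkn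
  have hleft := foRel_perp_rad_left hξ hnd h2 hk
  refine definesGeometry_of_foRel hξ hnd H hperp ?_
  have key : FORel (BotAdj ξ k) fun U W => ∀ X : Tang ξ k, Perp ξ (rad ξ X.1) W.1 →
      Perp ξ (rad ξ X.1) (rad ξ U.1) := by
    refine FORel.intro (FOPred.all (FOPred.imp ?_ ?_))
    · exact hleft.app (Sum.inr 0) (Sum.inl 1)
    · exact hperp.app (Sum.inr 0) (Sum.inl 0)
  exact key.congr fun U W => le_iff_perp hξ hnd H

end Codes

/-! ### Duality -/

section Duality

variable {F V : Type*} [Field F] [AddCommGroup V] [Module F V] [FiniteDimensional F V]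
variable {ξ : LinearMap.BilinForm F V} {k l : ℕ}

theorem rad_orthogonal (hξ : ξ.IsAlt) (hnd : ξ.Nondegenerate) (U : Submodule F V) :
    rad ξ (ξ.orthogonal U) = rad ξ U := by
  rw [rad, rad, LinearMap.BilinForm.orthogonal_orthogonal hnd hξ.isRefl, inf_comm]

/-- Orthogonal complements of tangential subspaces. -/
def tangDual (hξ : ξ.IsAlt) (hnd : ξ.Nondegenerate) (hkl : k + l = finrank F V) :
    Tang ξ k ≃ Tang ξ l where
  toFun U := ⟨ξ.orthogonal U.1, by
    rw [LinearMap.BilinForm.finrank_orthogonal hnd, U.2.1]; omega, by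
    rw [IsTangential, rad_orthogonal hξ hnd]; exact U.2.2⟩
  invFun U := ⟨ξ.orthogonal U.1, by
    rw [LinearMap.BilinForm.finrank_orthogonal hnd, U.2.1]; omega, by
    rw [IsTangential, rad_orthogonal hξ hnd]; exact U.2.2⟩
  left_inv U := Subtype.ext (LinearMap.BilinForm.orthogonal_orthogonal hnd hξ.isRefl U.1)
  right_inv U := Subtype.ext (LinearMap.BilinForm.orthogonal_orthogonal hnd hξ.isRefl U.1)

/-- U^⊥ ∩ W^⊥ = (U + W)^⊥ has the same radical as U + W, and a common (k + 1)-space of distinct U, W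
must be U + W. -/
theorem botAdj_tangDual (hξ : ξ.IsAlt) (hnd : ξ.Nondegenerate) (hkl : k + l = finrank F V)
    (hl : 1 ≤ l) (U W : Tang ξ k) :
    BotAdj ξ l (tangDual hξ hnd hkl U) (tangDual hξ hnd hkl W) ↔ TopAdj ξ k U W := by
  have e : (tangDual hξ hnd hkl U).1 ⊓ (tangDual hξ hnd hkl W).1 = ξ.orthogonal (U.1 ⊔ W.1) :=
    (orthogonal_sup U.1 W.1).symm
  have hd := LinearMap.BilinForm.finrank_orthogonal hnd (U.1 ⊔ W.1)
  have hsup := Submodule.finrank_le (U.1 ⊔ W.1)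
  have hreg : IsRegular ξ (ξ.orthogonal (U.1 ⊔ W.1)) ↔ IsRegular ξ (U.1 ⊔ W.1) := by
    rw [IsRegular, rad_orthogonal hξ hnd, IsRegular]
  rw [BotAdj, e, hreg]
  constructor
  · rintro ⟨h1, h2⟩
    refine ⟨?_, U.1 ⊔ W.1, by omega, h2, le_sup_left, le_sup_right⟩
    rintro rfl
    rw [sup_idem, U.2.1] at hd
    rw [sup_idem] at h1
    omega
  · rintro ⟨hne, B, hB, hBr, hUB, hWB⟩
    have hlt : U.1 < U.1 ⊔ W.1 := lt_of_le_of_ne le_sup_left fun e' =>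
      hne (Subtype.ext (Submodule.eq_of_le_of_finrank_eq (e' ▸ le_sup_right : W.1 ≤ U.1)
        (W.2.1.trans U.2.1.symm))).symm
    have h3 := Submodule.finrank_lt_finrank_of_lt hlt
    have hU := U.2.1
    have eB := Submodule.eq_of_le_of_finrank_le (sup_le hUB hWB) (by omega)
    rw [← eB] at hB hBr
    exact ⟨by omega, hBr⟩

/-- The dual dimension l = n - k is odd and at least 3, so the bottom case applies there.
Containment of Rad U in W becomes Rad U ⊥ W^⊥, which is why that relation was defined separately. -/
theorem definesGeometry_topAdj (hξ : ξ.IsAlt) (hnd : ξ.Nondegenerate) (h2 : (2 : F) ≠ 0)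
    (hk : 1 ≤ k) (hodd : Odd k) (hkn : k + 3 ≤ finrank F V) :
    DefinesGeometry ξ k (TopAdj ξ k) := by
  obtain ⟨l, hkl⟩ : ∃ l, k + l = finrank F V := ⟨finrank F V - k, by omega⟩
  have hlodd : Odd l := by
    obtain ⟨a, ha⟩ := hodd
    obtain ⟨b, hb⟩ := even_finrank hξ hnd
    exact ⟨b - a - 1, by omega⟩
  have hl : 3 ≤ l := by omega
  have H := fun p (hp : p ≠ 0) => exists_hasRad hξ hnd hodd (by omega) hp
  have hadj := botAdj_tangDual hξ hnd hkl (by omega)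
  have hperp := (foRel_perp_rad_rad hξ hnd h2 hl hlodd (by omega)).map (tangDual hξ hnd hkl) hadj
  have hleft := (foRel_perp_rad_left hξ hnd h2 hl).map (tangDual hξ hnd hkl) hadj
  have hrad : ∀ U : Tang ξ k, rad ξ (tangDual hξ hnd hkl U).1 = rad ξ U.1 :=
    fun U => rad_orthogonal hξ hnd U.1
  refine definesGeometry_of_foRel hξ hnd H (hperp.congr fun U W => ?_)
    (hleft.congr fun U W => ?_)
  · rw [hrad, hrad]
  · rw [hrad, perp_comm hξ]
    conv_lhs => rw [← LinearMap.BilinForm.orthogonal_orthogonal hnd hξ.isRefl W.1]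
    exact ⟨fun h w hw u hu => h hu w hw, fun h u hu w hw => h w hw u hu⟩

end Duality

end SympGeom

/-! ### Definability and rigidity for both adjacencies -/

theorem theorem4 {F V : Type*} [Field F] [AddCommGroup V] [Module F V] [FiniteDimensional F V]
    (hF : ringChar F ≠ 2) (ξ : LinearMap.BilinForm F V) (hξ : ξ.IsAlt) (hnd : ξ.Nondegenerate)
    (k : ℕ) (hk : Odd k) (hk1 : 1 ≤ k) (hkn : k + 1 ≤ finrank F V) :
    (k ≠ 1 → SympGeom.DefinesGeometry ξ k (SympGeom.BotAdj ξ k)) ∧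
    (k + 1 ≠ finrank F V → SympGeom.DefinesGeometry ξ k (SympGeom.TopAdj ξ k)) ∧
    (k ≠ 1 → ∀ f : SympGeom.Tang ξ k ≃ SympGeom.Tang ξ k,
      (∀ U W, SympGeom.BotAdj ξ k (f U) (f W) ↔ SympGeom.BotAdj ξ k U W) →
        ∃ φ : SympGeom.GeomAut ξ, φ.Induces f) ∧
    (k + 1 ≠ finrank F V → ∀ f : SympGeom.Tang ξ k ≃ SympGeom.Tang ξ k,
      (∀ U W, SympGeom.TopAdj ξ k (f U) (f W) ↔ SympGeom.TopAdj ξ k U W) →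
        ∃ φ : SympGeom.GeomAut ξ, φ.Induces f) := by
  have h2 : (2 : F) ≠ 0 := Ring.two_ne_zero hF
  have hbot : k ≠ 1 → SympGeom.DefinesGeometry ξ k (SympGeom.BotAdj ξ k) := fun h1 =>
    SympGeom.definesGeometry_botAdj hξ hnd h2 (by obtain ⟨a, ha⟩ := hk; omega) hk hkn
  have htop : k + 1 ≠ finrank F V → SympGeom.DefinesGeometry ξ k (SympGeom.TopAdj ξ k) :=
    fun h1 => SympGeom.definesGeometry_topAdj hξ hnd h2 hk1 hk (by
      obtain ⟨a, ha⟩ := hk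
      obtain ⟨b, hb⟩ := SympGeom.even_finrank hξ hnd
      omega)
  exact ⟨hbot, htop, fun h f hf => (hbot h).exists_induces f hf,
    fun h f hf => (htop h).exists_induces f hf⟩
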